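/- **Lemma.** Let $K\in\mathbb R$, $N\ge 1$. For $j\in\{1,2\}$ let $(X_i^j,d_i^j,\mathfrak m_i^j,p_i^j)_{i\in\mathbb N}$ be a sequence of pointed $\mathrm{RCD}^*(K,N)$ spaces such that $(X_i^j,p_i^j)$ converges in the pointed Gromov–Hausdorff sense to a pointed proper metric space $(X^j,p^j)$, with Gromov–Hausdorff approximations $\varphi_i^j:X_i^j\to X^j\cup\{*\}$. Let $f_i:X_i^1\to X_i^2$ be a sequence of maps that is good at all scales. Then, after passing to a subsequence, $f_i$ converges weakly (with respect to $\varphi_i^1,\varphi_i^2$) to a surjective isometry $f_\infty:X^1\to X^2$. The notions used are the following. $B_r(x)$ denotes an open ball, and sets are understood to be Borel. * *$\mathrm{RCD}^*(K,N)$ space*: a complete separable metric space with a Borel measure of full support, finite on bounded sets, that satisfies the reduced curvature-dimension condition $\mathrm{CD}^*(K,N)$ of Bacher–Sturm and is infinitesimally Hilbertian (the Cheeger energy satisfies the parallelogram identity on $L^2$). Such a space is proper. * *Gromov–Hausdorff approximations*: the point $*$ is at infinite distance from every point of $X^j$, and the maps $\varphi_i:X_i\to X\cup\{*\}$ satisfy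 $\varphi_i(p_i)\to p$ and, for each $R>0$: $\varphi_i^{-1}(B_R(p))\subset B_{2R}(p_i)$ for $i$ large enough, $\sup_{x,x'\in B_{2R}(p_i)}|d(\varphi_i(x),\varphi_i(x'))-d(x,x')|\to 0$, and $\sup_{y\in B_R(p)}\inf_{x\in B_{2R}(p_i)}d(\varphi_i(x),y)\to 0$. * *Asymptotically full measure*: sets $U_i\subset X_i^j$ have asymptotically full measure if $\mathfrak m_i^j(U_i\cap B_R(p_i^j))/\mathfrak m_i^j(B_R(p_i^j))\to 1$ for every $R>0$. * *Weak convergence*: $f_i$ converges weakly to $f_\infty$ if there are sets $U_i\subset X_i^1$ of asymptotically full measure with $\lim_{i\to\infty}\sup_{x\in U_i}d(\varphi_i^2f_i(x),f_\infty\varphi_i^1(x))=0$, where $f_\infty(*)=*$. * *Distortion and essential continuity*: for $r>0$ let $\mathrm{dt}_r(f)(a,b)=\min\{r,|d(a,b)-d(f(a),f(b))|\}$. A point $x$ is a point of essential continuity of $f$ if there is $r_0>0$ such that for all $0<r\le r_0$ there is $A\subset B_r(x)$ with $\mathfrak m(A)\ge\frac12\mathfrak m(B_r(x))$ and $f(A)\subset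 B_{2r}(f(x))$. * *Good at all scales*: the maps $f_i$ are measurable and there are measurable maps $g_i:X_i^2\to X_i^1$ with $g_i\circ f_i=\mathrm{Id}$ and $f_i\circ g_i=\mathrm{Id}$ almost everywhere, such that: 1. $(f_i)_*\mathfrak m_i^1\ll\mathfrak m_i^2$ and $(g_i)_*\mathfrak m_i^2\ll\mathfrak m_i^1$ for all $i$; 2. there are $R_0>0$ and sets $S_i^j\subset B_1(p_i^j)$ with $\mathfrak m_i^j(S_i^j)\ge\frac12\mathfrak m_i^j(B_1(p_i^j))$, $f_i(S_i^1)\subset B_{R_0}(p_i^2)$ and $g_i(S_i^2)\subset B_{R_0}(p_i^1)$; 3. there are $\varepsilon_i\to0$ and sets $U_i^j\subset X_i^j$ of asymptotically full measure such that the points of $U_i^1$ (resp. $U_i^2$) are of essential continuity of $f_i$ (resp. $g_i$), the restriction of $f_i$ to $U_i^1$ (resp. of $g_i$ to $U_i^2$) is measure preserving onto its image, and for all $x\in U_i^1$, $y\in U_i^2$ and $0<r\le 1$, the average of $\mathrm{dt}_r(f_i)$ over $B_r(x)\times B_r(x)$ with respect to $\mathfrak m_i^1\times\mathfrak m_i^1$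 and the average of $\mathrm{dt}_r(g_i)$ over $B_r(y)\times B_r(y)$ with respect to $\mathfrak m_i^2\times\mathfrak m_i^2$ are at most $\varepsilon_i r$. -/

import Mathlib

open MeasureTheory Filter Topology Metric
open scoped NNReal ENNReal

noncomputable section

namespace RCD

/-! ### Optimal transport -/

section Transport

variable {X : Type*} [MetricSpace X] [MeasurableSpace X]

/-- `q` is a coupling of `μ` and `ν`. -/
def IsCoupling (μ ν : Measure X) (q : Measure (X × X)) : Prop :=
  q.map Prod.fst = μ ∧ q.map Prod.snd = ν

/-- The quadratic transport cost of a coupling. -/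
def transportCost (q : Measure (X × X)) : ℝ≥0∞ :=
  ∫⁻ z, edist z.1 z.2 ^ 2 ∂q

/-- `q` is an optimal coupling of `μ` and `ν` for the quadratic cost. -/
def IsOptimalCoupling (μ ν : Measure X) (q : Measure (X × X)) : Prop :=
  IsCoupling μ ν q ∧ ∀ q', IsCoupling μ ν q' → transportCost q ≤ transportCost q'

/-- The `L²`-Wasserstein distance. -/
def W2 (μ ν : Measure X) : ℝ≥0∞ :=
  (⨅ (q : Measure (X × X)) (_ : IsCoupling μ ν q), transportCost q) ^ (1 / 2 : ℝ)

/-- `μ ∈ P_∞(X, d, m)`: a probability measure of bounded support, absolutely continuous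
with respect to `m`. -/
def MemPInfty (m μ : Measure X) : Prop :=
  IsProbabilityMeasure μ ∧ μ ≪ m ∧ ∃ B : Set X, Bornology.IsBounded B ∧ μ Bᶜ = 0

/-- `t ↦ Γ t`, `t ∈ [0,1]`, is a constant speed geodesic from `μ` to `ν` in
`(P_∞(X, d, m), W₂)`. -/
def IsWassersteinGeodesic (m μ ν : Measure X) (Γ : ℝ → Measure X) : Prop :=
  Γ 0 = μ ∧ Γ 1 = ν ∧ (∀ t ∈ Set.Icc (0 : ℝ) 1, MemPInfty m (Γ t)) ∧
    ∀ s ∈ Set.Icc (0 : ℝ) 1, ∀ t ∈ Set.Icc (0 : ℝ) 1,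
      W2 (Γ s) (Γ t) = ENNReal.ofReal |t - s| * W2 μ ν

/-- The distortion coefficient `σ_{K,N}^{(t)}(θ)` of the reduced curvature-dimension condition. -/
def sigmaCoeff (K N t θ : ℝ) : ℝ≥0∞ :=
  if N * Real.pi ^ 2 ≤ K * θ ^ 2 then ⊤
  else if 0 < K * θ ^ 2 then
    ENNReal.ofReal (Real.sin (t * θ * √(K / N)) / Real.sin (θ * √(K / N)))
  else if K * θ ^ 2 = 0 then ENNReal.ofReal t
  else ENNReal.ofReal (Real.sinh (t * θ * √(-K / N)) / Real.sinh (θ * √(-K / N)))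

/-- Minus the `N`-Rényi entropy, `-S_N(μ | m) = ∫ ρ ^ (-1/N) dμ`, of `μ = ρ m`. -/
def negRenyi (N : ℝ) (m μ : Measure X) : ℝ≥0∞ :=
  ∫⁻ x, μ.rnDeriv m x ^ (-1 / N) ∂μ

/-- The reduced curvature-dimension condition `CD*(K, N)` of Bacher and Sturm. -/
def IsCDStar (K N : ℝ) (m : Measure X) : Prop :=
  ∀ μ₀ μ₁ : Measure X, MemPInfty m μ₀ → MemPInfty m μ₁ →
    ∃ (q : Measure (X × X)) (Γ : ℝ → Measure X),
      IsOptimalCoupling μ₀ μ₁ q ∧ IsWassersteinGeodesic m μ₀ μ₁ Γ ∧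
      ∀ t ∈ Set.Icc (0 : ℝ) 1, ∀ N' : ℝ, N ≤ N' →
        ∫⁻ z, (sigmaCoeff K N' (1 - t) (dist z.1 z.2) * μ₀.rnDeriv m z.1 ^ (-1 / N') +
            sigmaCoeff K N' t (dist z.1 z.2) * μ₁.rnDeriv m z.2 ^ (-1 / N')) ∂q
          ≤ negRenyi N' m (Γ t)

/-! ### The Cheeger energy -/

/-- The local Lipschitz constant `limsup_{y → x} |f y - f x| / d(y, x)`
(equal to `0` at isolated points). -/
def localLip (f : X → ℝ) (x : X) : ℝ≥0∞ :=
  limsup (fun y => edist (f y) (f x) / edist y x) (𝓝[≠] x)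

/-- The Cheeger energy: the `L²(m)`-relaxation of `f ↦ ½ ∫ (lip f)² dm` on Lipschitz functions. -/
def cheegerEnergy (m : Measure X) (f : X → ℝ) : ℝ≥0∞ :=
  ⨅ (g : ℕ → X → ℝ) (_ : ∀ n, ∃ C : ℝ≥0, LipschitzWith C (g n)) (_ : ∀ n, MemLp (g n) 2 m)
    (_ : Tendsto (fun n => eLpNorm (g n - f) 2 m) atTop (𝓝 0)),
    liminf (fun n => (1 / 2 : ℝ≥0∞) * ∫⁻ x, localLip (g n) x ^ 2 ∂m) atTop

/-- Infinitesimal Hilbertianity: the Cheeger energy satisfies the parallelogram identity on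
`L²(m)`, that is, the Sobolev space `W^{1,2}` is a Hilbert space. -/
def IsInfinitesimallyHilbertian (m : Measure X) : Prop :=
  ∀ f g : X → ℝ, MemLp f 2 m → MemLp g 2 m →
    cheegerEnergy m (f + g) + cheegerEnergy m (f - g) =
      2 * cheegerEnergy m f + 2 * cheegerEnergy m g

/-- `(X, d, m)` is an `RCD*(K, N)` space, `1 ≤ N < ∞`: a complete separable metric space with a
Borel measure of full support, finite on bounded sets, that satisfies `CD*(K, N)` and is
infinitesimally Hilbertian. -/
structure IsRCDStar (K N : ℝ) (m : Measure X) : Prop where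
  one_le : 1 ≤ N
  complete : CompleteSpace X
  separable : TopologicalSpace.SeparableSpace X
  borel : BorelSpace X
  ball_lt_top : ∀ (x : X) (r : ℝ), m (ball x r) < ⊤
  fullSupport : ∀ (x : X) (r : ℝ), 0 < r → 0 < m (ball x r)
  cdStar : IsCDStar K N m
  infHilbertian : IsInfinitesimallyHilbertian m

end Transport

/-! ### Pointed Gromov--Hausdorff convergence -/

section GromovHausdorff

/-- The distance of `Y ∪ {∗}`, where the added point `∗ = none` is at infinite distance from
all points of `Y`. -/
def extDist {Y : Type*} [MetricSpace Y] : Option Y → Option Y → ℝ≥0∞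
  | some x, some y => edist x y
  | none, none => 0
  | _, _ => ⊤

/-- The absolute difference `|a - b|` of two extended nonnegative numbers. -/
def absDiff (a b : ℝ≥0∞) : ℝ≥0∞ := (a - b) + (b - a)

/-- `φ i : X i → Y ∪ {∗}` are Gromov--Hausdorff approximations, witnessing that the pointed
spaces `(X i, p i)` converge to `(Y, y)` in the Gromov--Hausdorff sense. -/
structure IsGHApprox {X : ℕ → Type*} [∀ i, MetricSpace (X i)] {Y : Type*} [MetricSpace Y]
    (p : ∀ i, X i) (y : Y) (φ : ∀ i, X i → Option Y) : Prop where
  base : Tendsto (fun i => extDist (φ i (p i)) (some y)) atTop (𝓝 0)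
  preimage_ball : ∀ R : ℝ, 0 < R → ∀ᶠ i in atTop, ∀ x : X i,
    extDist (φ i x) (some y) < ENNReal.ofReal R → x ∈ ball (p i) (2 * R)
  distortion : ∀ R : ℝ, 0 < R → Tendsto (fun i =>
    ⨆ x₁ ∈ ball (p i) (2 * R), ⨆ x₂ ∈ ball (p i) (2 * R),
      absDiff (extDist (φ i x₁) (φ i x₂)) (edist x₁ x₂)) atTop (𝓝 0)
  dense : ∀ R : ℝ, 0 < R → Tendsto (fun i =>
    ⨆ z ∈ ball y R, ⨅ x ∈ ball (p i) (2 * R), extDist (φ i x) (some z)) atTop (𝓝 0)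

end GromovHausdorff

/-! ### Maps that are good at all scales, and weak convergence -/

section GoodAtAllScales

/-- The distortion of `f` at scale `r`. -/
def distortion {X Y : Type*} [MetricSpace X] [MetricSpace Y] (r : ℝ) (f : X → Y) (a b : X) : ℝ :=
  min r |dist a b - dist (f a) (f b)|

/-- `x` is a point of essential continuity of `f`. -/
def IsEssContPoint {X Y : Type*} [MetricSpace X] [MeasurableSpace X] [MetricSpace Y]
    (m : Measure X) (f : X → Y) (x : X) : Prop :=
  ∃ r₀ : ℝ, 0 < r₀ ∧ ∀ r : ℝ, 0 < r → r ≤ r₀ → ∃ A ⊆ ball x r, MeasurableSet A ∧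
    m (ball x r) / 2 ≤ m A ∧ Set.MapsTo f A (ball (f x) (2 * r))

/-- The sets `U i` have asymptotically full measure in the pointed spaces `(X i, m i, p i)`. -/
def AsympFullMeasure {X : ℕ → Type*} [∀ i, MetricSpace (X i)] [∀ i, MeasurableSpace (X i)]
    (m : ∀ i, Measure (X i)) (p : ∀ i, X i) (U : ∀ i, Set (X i)) : Prop :=
  ∀ R : ℝ, 0 < R →
    Tendsto (fun i => m i (U i ∩ ball (p i) R) / m i (ball (p i) R)) atTop (𝓝 1)

/-- The map `f` is controlled on `U`, with error `ε`: points of `U` are of essential continuity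
of `f`, the restriction of `f` to `U` is measure preserving (onto its image), and around points
of `U` the mean distortion of `f` at each scale `r ≤ 1` is at most `ε r`. -/
structure IsControlledOn {X Y : Type*} [MetricSpace X] [MeasurableSpace X] [MetricSpace Y]
    [MeasurableSpace Y] (m : Measure X) (n : Measure Y) (f : X → Y) (U : Set X) (ε : ℝ) :
    Prop where
  essCont : ∀ x ∈ U, IsEssContPoint m f x
  measurePreserving : MeasurePreserving f (m.restrict U) (n.restrict (f '' U))
  meanDistortion : ∀ x ∈ U, ∀ r : ℝ, 0 < r → r ≤ 1 →
    ⨍ z in ball x r ×ˢ ball x r, distortion r f z.1 z.2 ∂(m.prod m) ≤ ε * r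

variable {X Y : ℕ → Type*} [∀ i, MetricSpace (X i)] [∀ i, MeasurableSpace (X i)]
  [∀ i, MetricSpace (Y i)] [∀ i, MeasurableSpace (Y i)]

/-- The sequence of maps `f i : [X i, p i] → [Y i, q i]` is good at all scales. -/
def IsGoodAtAllScales (m : ∀ i, Measure (X i)) (p : ∀ i, X i) (n : ∀ i, Measure (Y i))
    (q : ∀ i, Y i) (f : ∀ i, X i → Y i) : Prop :=
  (∀ i, Measurable (f i)) ∧
  ∃ g : ∀ i, Y i → X i, (∀ i, Measurable (g i)) ∧
    (∀ i, ∀ᵐ x ∂(m i), g i (f i x) = x) ∧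
    (∀ i, ∀ᵐ y ∂(n i), f i (g i y) = y) ∧
    (∀ i, (m i).map (f i) ≪ n i) ∧
    (∀ i, (n i).map (g i) ≪ m i) ∧
    (∃ R₀ : ℝ, 0 < R₀ ∧ ∃ (S : ∀ i, Set (X i)) (T : ∀ i, Set (Y i)), ∀ i,
      (S i ⊆ ball (p i) 1 ∧ MeasurableSet (S i) ∧ m i (ball (p i) 1) / 2 ≤ m i (S i) ∧
        Set.MapsTo (f i) (S i) (ball (q i) R₀)) ∧
      (T i ⊆ ball (q i) 1 ∧ MeasurableSet (T i) ∧ n i (ball (q i) 1) / 2 ≤ n i (T i) ∧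
        Set.MapsTo (g i) (T i) (ball (p i) R₀))) ∧
    ∃ ε : ℕ → ℝ, Tendsto ε atTop (𝓝 0) ∧
      ∃ (U : ∀ i, Set (X i)) (V : ∀ i, Set (Y i)),
        (∀ i, MeasurableSet (U i)) ∧ (∀ i, MeasurableSet (V i)) ∧
        AsympFullMeasure m p U ∧ AsympFullMeasure n q V ∧
        (∀ i, IsControlledOn (m i) (n i) (f i) (U i) (ε i)) ∧
        (∀ i, IsControlledOn (n i) (m i) (g i) (V i) (ε i))

/-- The maps `f i : X i → Y i` converge weakly to `F : X' → Y'`, with respect to the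
Gromov--Hausdorff approximations `φ i : X i → X' ∪ {∗}` and `ψ i : Y i → Y' ∪ {∗}`;
here `F` is extended by `F ∗ = ∗`. -/
def ConvergesWeakly {X' Y' : Type*} [MetricSpace Y'] (m : ∀ i, Measure (X i)) (p : ∀ i, X i)
    (φ : ∀ i, X i → Option X') (ψ : ∀ i, Y i → Option Y') (f : ∀ i, X i → Y i)
    (F : X' → Y') : Prop :=
  ∃ U : ∀ i, Set (X i), (∀ i, MeasurableSet (U i)) ∧ AsympFullMeasure m p U ∧
    Tendsto (fun i => ⨆ x ∈ U i, extDist (ψ i (f i x)) ((φ i x).map F)) atTop (𝓝 0)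

end GoodAtAllScales

end RCD

end

universe u

/-! The limit map is obtained by following, for each point `y` of the limit space, points `a i` near
`y` at which `f i` almost preserves the distance to most nearby points.

Such points exist by Chebyshev and Fubini: the mean distortion over a unit ball tends to 0, so pairs
with distortion above a threshold fill a vanishing fraction of the product, while uniform doubling
keeps every small ball a definite fraction of the unit ball (`exists_goodLift`). If two such
sequences are close, a third point that is bad for neither of them compares the two image distances,
so short distances pass to the limit (`GoodLift.tendsto_dist_map`). The sets of half measure in the
unit balls keep the images bounded (`GoodLift.exists_map_mem_ball`), hence a subsequence yields
limits `F` of `f i` and `G` of `g i` that preserve short distances. The limit spaces have midpoints,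
so `F` and `G` are 1-Lipschitz. A generic point near `a i` satisfies `g i (f i x) = x` and is good
for both maps, whence `G ∘ F = id`, and symmetrically (`IsLimitMap.leftInverse`). Mutually inverse
1-Lipschitz maps are isometries.

The curvature condition supplies the uniform doubling and the approximate midpoints. Both come from
the Wasserstein midpoint of the uniform measures on two balls: it is concentrated near geometric
midpoints, and the Rényi entropy inequality bounds below the measure of any set carrying it
(`IsRCDStar.exists_midpoint_measure`). -/

namespace RCD

/-! ### Gluing of couplings -/

section Gluing

open ProbabilityTheory

theorem IsCoupling.isProbabilityMeasure {X : Type*} [MetricSpace X] [MeasurableSpace X]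
    {μ ν : Measure X} [IsProbabilityMeasure μ] {q : Measure (X × X)} (h : IsCoupling μ ν q) :
    IsProbabilityMeasure q := by
  constructor
  have h1 : μ Set.univ = 1 := measure_univ
  rwa [← h.1, Measure.map_apply measurable_fst MeasurableSet.univ, Set.preimage_univ] at h1

/-- Two couplings with a common marginal can be glued together. -/
theorem exists_gluing {X : Type*} [MeasurableSpace X] [StandardBorelSpace X] [Nonempty X]
    (q₀ q₁ : Measure (X × X)) [IsProbabilityMeasure q₀] [IsProbabilityMeasure q₁]
    (h : q₀.map Prod.snd = q₁.map Prod.fst) :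
    ∃ π : Measure (X × X × X), π.map (fun z => (z.2.1, z.1)) = q₀ ∧
      π.map (fun z => (z.1, z.2.2)) = q₁ := by
  set q₀' := q₀.map Prod.swap with hq₀'
  have : IsProbabilityMeasure q₀' := Measure.isProbabilityMeasure_map measurable_swap.aemeasurable
  have hfst : q₀'.fst = q₁.fst := by
    rw [Measure.fst, Measure.fst, ← h, hq₀', Measure.map_map measurable_fst measurable_swap]
    rfl
  set κ := q₀'.condKernel
  set η := q₁.condKernel
  -- The first coordinate carries the common marginal; given it, the two others are taken
  -- conditionally independent.
  refine ⟨q₁.fst ⊗ₘ (κ ×ₖ η), ?_, ?_⟩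
  · have h1 : (q₁.fst ⊗ₘ (κ ×ₖ η)).map (Prod.map id Prod.fst) = q₀' := by
      rw [← Measure.compProd_map measurable_fst, ← Kernel.fst_eq, Kernel.fst_prod, ← hfst]
      exact q₀'.disintegrate q₀'.condKernel
    have h2 : q₀ = q₀'.map Prod.swap := by
      rw [hq₀', Measure.map_map measurable_swap measurable_swap]
      simp
    rw [h2, ← h1, Measure.map_map measurable_swap (by fun_prop)]
    rfl
  · have h1 : (q₁.fst ⊗ₘ (κ ×ₖ η)).map (Prod.map id Prod.snd) = q₁ := by
      rw [← Measure.compProd_map measurable_snd, ← Kernel.snd_eq, Kernel.snd_prod]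
      exact q₁.disintegrate q₁.condKernel
    conv_rhs => rw [← h1]
    rfl

end Gluing

/-! ### Distortion coefficients and densities of uniform measures -/

/-- By the duplication formulas the coefficient is `1 / (2 cos (α / 2)) ≥ 1 / 2` for positive
curvature and `1 / (2 cosh (s / 2))`, decreasing in `s`, for negative curvature. For `K ≥ 0` the
square root of `-K / N` is 0, so the single bound reads `1 / 2`. -/
theorem le_sigmaCoeff_half {K N θ L : ℝ} (hN : 1 ≤ N) (hθ : 0 ≤ θ) (hθL : θ ≤ L) :
    ENNReal.ofReal (1 / (2 * Real.cosh (L * √(-K / N) / 2))) ≤ sigmaCoeff K N (1 / 2) θ := by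
  have hN0 : 0 < N := by linarith
  have hc1 : 1 / (2 * Real.cosh (L * √(-K / N) / 2)) ≤ 1 / 2 := by
    have := Real.one_le_cosh (L * √(-K / N) / 2)
    apply one_div_le_one_div_of_le <;> linarith
  unfold sigmaCoeff
  split_ifs with h1 h2 h3
  · exact le_top
  · apply ENNReal.ofReal_le_ofReal
    refine hc1.trans ?_
    have hK : 0 < K := by
      by_contra hK
      nlinarith [sq_nonneg θ]
    have hθ' : 0 < θ := lt_of_le_of_ne hθ (by rintro rfl; simp at h2)
    set α := θ * √(K / N) with hα
    have hα0 : 0 < α := by positivity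
    have hαπ : α < Real.pi := by
      refine lt_of_pow_lt_pow_left₀ 2 Real.pi_pos.le ?_
      rw [hα, mul_pow, Real.sq_sqrt (by positivity)]
      rw [mul_div_assoc', div_lt_iff₀ hN0]
      nlinarith
    have e : 1 / 2 * θ * √(K / N) = α / 2 := by rw [hα]; ring
    have hs := Real.sin_pos_of_pos_of_lt_pi hα0 hαπ
    have hs2 := Real.sin_pos_of_pos_of_lt_pi (half_pos hα0) (by linarith)
    rw [e, le_div_iff₀ hs]
    have := Real.sin_two_mul (α / 2)
    rw [mul_div_cancel₀ _ (two_ne_zero)] at this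
    rw [this]
    nlinarith [Real.cos_le_one (α / 2)]
  · exact ENNReal.ofReal_le_ofReal hc1
  · apply ENNReal.ofReal_le_ofReal
    have hneg : K * θ ^ 2 < 0 := lt_of_le_of_ne (not_lt.1 h2) h3
    have hθ' : 0 < θ := lt_of_le_of_ne hθ (by rintro rfl; simp at hneg)
    have hK : K < 0 := by
      by_contra hK
      nlinarith [sq_nonneg θ, mul_nonneg (not_lt.1 hK) (sq_nonneg θ)]
    have hKN : 0 < √(-K / N) := Real.sqrt_pos.2 (div_pos (by linarith) hN0)
    set s := θ * √(-K / N) with hs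
    have hs0 : 0 < s := by positivity
    have e : 1 / 2 * θ * √(-K / N) = s / 2 := by rw [hs]; ring
    rw [e]
    have h2 := Real.sinh_two_mul (s / 2)
    rw [mul_div_cancel₀ _ (two_ne_zero)] at h2
    have hsp : 0 < Real.sinh (s / 2) := Real.sinh_pos_iff.2 (by positivity)
    have hcp := Real.cosh_pos (s / 2)
    rw [h2]
    have e2 : Real.sinh (s / 2) / (2 * Real.sinh (s / 2) * Real.cosh (s / 2)) =
        1 / (2 * Real.cosh (s / 2)) := by field_simp
    rw [e2]
    apply one_div_le_one_div_of_le (by positivity)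
    have : Real.cosh (s / 2) ≤ Real.cosh (L * √(-K / N) / 2) := by
      rw [Real.cosh_le_cosh, abs_of_pos (by positivity)]
      refine le_trans ?_ (le_abs_self _)
      rw [hs]
      gcongr
    linarith

theorem ae_cond_rnDeriv {X : Type*} [MeasurableSpace X] {m : Measure X} [SigmaFinite m]
    {A : Set X} (hAm : MeasurableSet A) :
    ∀ᵐ z ∂(ProbabilityTheory.cond m A), (ProbabilityTheory.cond m A).rnDeriv m z = (m A)⁻¹ := by
  have e : ProbabilityTheory.cond m A = m.withDensity (A.indicator fun _ => (m A)⁻¹) := by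
    rw [withDensity_indicator hAm, withDensity_const]
    rfl
  have h1 : (ProbabilityTheory.cond m A).rnDeriv m =ᵐ[m] A.indicator fun _ => (m A)⁻¹ := by
    conv_lhs => rw [e]
    exact Measure.rnDeriv_withDensity _ (measurable_const.indicator hAm)
  have h2 := ProbabilityTheory.cond_absolutelyContinuous (μ := m) (s := A) h1
  filter_upwards [h2, ProbabilityTheory.ae_cond_mem hAm] with z hz hzA
  rw [hz, Set.indicator_of_mem hzA]

/-! ### Wasserstein midpoints, entropy and volume comparison -/

section Transport

variable {X : Type*} [MetricSpace X] [MeasurableSpace X]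

theorem W2_sq (μ ν : Measure X) :
    W2 μ ν ^ 2 = ⨅ (q : Measure (X × X)) (_ : IsCoupling μ ν q), transportCost q := by
  rw [W2, ← ENNReal.rpow_natCast, ← ENNReal.rpow_mul]
  norm_num

theorem W2_sq_le {μ ν : Measure X} {q : Measure (X × X)} (h : IsCoupling μ ν q) :
    W2 μ ν ^ 2 ≤ transportCost q := by
  rw [W2_sq]
  exact iInf₂_le q h

theorem exists_coupling_lt {μ ν : Measure X} {c : ℝ≥0∞} (h : W2 μ ν ^ 2 < c) :
    ∃ q, IsCoupling μ ν q ∧ transportCost q < c := by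
  rw [W2_sq] at h
  simpa only [iInf_lt_iff, exists_prop] using h

/-- Write `2a² + 2b² = (a + b)² + (a - b)²`. Either `a + b ≤ L + δ`, which forces `a - b ≥ δ`, or `a
+ b ≥ L + δ ≥ D + δ`. A point too far from being a midpoint thus costs an extra `δ²`. -/
theorem midpoint_excess {a b D L δ : ℝ} (hD : 0 ≤ D) (hDL : D ≤ L) (hDab : D ≤ a + b)
    (hδ : 0 ≤ δ) (ha : L / 2 + δ ≤ a) : δ ^ 2 + D ^ 2 ≤ 2 * a ^ 2 + 2 * b ^ 2 := by
  rcases le_total (a + b) (L + δ) with h | h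
  · nlinarith [mul_self_nonneg (a - b - δ)]
  · nlinarith [sq_nonneg (a - b)]

/-- The uniform probability measure on a set of positive finite measure is admissible. -/
theorem memPInfty_cond {m : Measure X} {A : Set X} (hA0 : m A ≠ 0)
    (hAf : m A ≠ ⊤) (hAm : MeasurableSet A) (hAb : Bornology.IsBounded A) :
    MemPInfty m (ProbabilityTheory.cond m A) := by
  refine ⟨ProbabilityTheory.cond_isProbabilityMeasure_of_finite hA0 hAf,
    ProbabilityTheory.cond_absolutelyContinuous, A, hAb, ?_⟩
  rw [ProbabilityTheory.cond_apply hAm]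
  simp

variable [ProperSpace X]

namespace IsRCDStar

theorem sigmaFinite {K N : ℝ} {m : Measure X} (h : IsRCDStar K N m) : SigmaFinite m := by
  have : IsLocallyFiniteMeasure m := ⟨fun x => ⟨ball x 1, ball_mem_nhds x one_pos,
    h.ball_lt_top x 1⟩⟩
  infer_instance

end IsRCDStar

variable [BorelSpace X]

/-- A midpoint in the Wasserstein space of two measures concentrated on `A` and `B` is
concentrated near the midpoints of points of `A` and `B`. -/
theorem wasserstein_midpoint_ae {μ₀ μ₁ ν : Measure X} [IsProbabilityMeasure μ₀]
    [IsProbabilityMeasure ν] [IsProbabilityMeasure μ₁] {A B : Set X}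
    (hAm : MeasurableSet A) (hBm : MeasurableSet B) (hA : ∀ᵐ z ∂μ₀, z ∈ A)
    (hB : ∀ᵐ z ∂μ₁, z ∈ B) {L δ : ℝ} (hδ : 0 < δ) (hL : ∀ a ∈ A, ∀ b ∈ B, dist a b ≤ L)
    (h₀ : W2 μ₀ ν ^ 2 = W2 μ₀ μ₁ ^ 2 / 4) (h₁ : W2 ν μ₁ ^ 2 = W2 μ₀ μ₁ ^ 2 / 4)
    (hfin : W2 μ₀ μ₁ ≠ ⊤) :
    ∀ᵐ z ∂ν, (∃ a ∈ A, dist a z < L / 2 + δ) ∧ ∃ b ∈ B, dist z b < L / 2 + δ := by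
  have hne : Nonempty X := nonempty_of_isProbabilityMeasure μ₀
  set I := W2 μ₀ μ₁ ^ 2 with hI
  have hIfin : I ≠ ⊤ := by finiteness
  set E : Set X := {z | (∀ a ∈ A, L / 2 + δ ≤ dist a z) ∨ ∀ b ∈ B, L / 2 + δ ≤ dist z b} with hE
  have hEm : MeasurableSet E := by
    have e : E = (⋂ a ∈ A, {z | L / 2 + δ ≤ dist a z}) ∪ ⋂ b ∈ B, {z | L / 2 + δ ≤ dist z b} := by
      ext z; simp [hE]
    rw [e]
    refine (IsClosed.union ?_ ?_).measurableSet
    · exact isClosed_biInter fun a _ => isClosed_le continuous_const (by fun_prop)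
    · exact isClosed_biInter fun a _ => isClosed_le continuous_const (by fun_prop)
  have key : ∀ η : ℝ≥0∞, 0 < η → ENNReal.ofReal (δ ^ 2) * ν E ≤ 4 * η := by
    intro η hη
    rcases eq_or_ne η ⊤ with rfl | hηt
    · simp
    -- The infimum defining `W2` need not be attained, so couplings optimal up to `η` are glued
    -- along `ν`. The total cost then exceeds `I` by at most `4η`, while each point of `E` costs
    -- `δ²` more.
    have hlt : I / 4 < I / 4 + η := ENNReal.lt_add_right (by finiteness) hη.ne'
    obtain ⟨q₀, hq₀, hc₀⟩ := exists_coupling_lt (h₀.trans_lt hlt)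
    obtain ⟨q₁, hq₁, hc₁⟩ := exists_coupling_lt (h₁.trans_lt hlt)
    have := hq₀.isProbabilityMeasure
    have := hq₁.isProbabilityMeasure
    obtain ⟨π, hπ₀, hπ₁⟩ := exists_gluing q₀ q₁ (hq₀.2.trans hq₁.1.symm)
    have m0 : Measurable (fun z : X × X × X => (z.2.1, z.1)) := by fun_prop
    have m1 : Measurable (fun z : X × X × X => (z.1, z.2.2)) := by fun_prop
    have m2 : Measurable (fun z : X × X × X => z.2) := by fun_prop
    have e0 : π.map (fun z => z.2.1) = μ₀ := by
      rw [← hq₀.1, ← hπ₀, Measure.map_map measurable_fst m0]; rfl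
    have e1 : π.map (fun z => z.2.2) = μ₁ := by
      rw [← hq₁.2, ← hπ₁, Measure.map_map measurable_snd m1]; rfl
    have et : π.map (fun z => z.1) = ν := by
      rw [← hq₁.1, ← hπ₁, Measure.map_map measurable_fst m1]; rfl
    have hcpl : IsCoupling μ₀ μ₁ (π.map fun z => z.2) := by
      constructor
      · rw [Measure.map_map measurable_fst m2]; exact e0
      · rw [Measure.map_map measurable_snd m2]; exact e1
    have hms : Measurable (fun z : X × X => edist z.1 z.2 ^ 2) := by fun_prop
    have c0 : ∫⁻ z, edist z.2.1 z.1 ^ 2 ∂π < I / 4 + η := by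
      rwa [transportCost, ← hπ₀, lintegral_map hms m0] at hc₀
    have c1 : ∫⁻ z, edist z.1 z.2.2 ^ 2 ∂π < I / 4 + η := by
      rwa [transportCost, ← hπ₁, lintegral_map hms m1] at hc₁
    have cI : I ≤ ∫⁻ z, edist z.2.1 z.2.2 ^ 2 ∂π := by
      have := W2_sq_le hcpl
      rwa [transportCost, lintegral_map hms m2] at this
    have a0 : ∀ᵐ z ∂π, z.2.1 ∈ A := by
      rw [← e0] at hA
      exact (ae_map_iff (by fun_prop) hAm).1 hA
    have a1 : ∀ᵐ z ∂π, z.2.2 ∈ B := by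
      rw [← e1] at hB
      exact (ae_map_iff (by fun_prop) hBm).1 hB
    have hpt : ∀ᵐ z ∂π, ENNReal.ofReal (δ ^ 2) * (Prod.fst ⁻¹' E).indicator 1 z +
        edist z.2.1 z.2.2 ^ 2 ≤ 2 * edist z.2.1 z.1 ^ 2 + 2 * edist z.1 z.2.2 ^ 2 := by
      filter_upwards [a0, a1] with z hz0 hz1
      simp only [edist_dist]
      have tri := dist_triangle z.2.1 z.1 z.2.2
      have two : (2 : ℝ≥0∞) = ENNReal.ofReal 2 := by simp
      by_cases hz : z.1 ∈ E
      · rw [Set.indicator_of_mem (by exact hz)]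
        simp only [Pi.one_apply, mul_one]
        rw [two, ← ENNReal.ofReal_pow dist_nonneg, ← ENNReal.ofReal_pow dist_nonneg,
          ← ENNReal.ofReal_pow dist_nonneg, ← ENNReal.ofReal_mul (by norm_num),
          ← ENNReal.ofReal_mul (by norm_num), ← ENNReal.ofReal_add (by positivity) (by positivity),
          ← ENNReal.ofReal_add (by positivity) (by positivity)]
        apply ENNReal.ofReal_le_ofReal
        rcases hz with hz | hz
        · exact midpoint_excess dist_nonneg (hL _ hz0 _ hz1) tri hδ.le (hz _ hz0)
        · rw [add_comm (2 * _)]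
          exact midpoint_excess dist_nonneg (hL _ hz0 _ hz1) (by linarith) hδ.le (hz _ hz1)
      · rw [Set.indicator_of_notMem (by exact hz)]
        rw [two, ← ENNReal.ofReal_pow dist_nonneg, ← ENNReal.ofReal_pow dist_nonneg,
          ← ENNReal.ofReal_pow dist_nonneg, ← ENNReal.ofReal_mul (by norm_num),
          ← ENNReal.ofReal_mul (by norm_num), mul_zero, zero_add,
          ← ENNReal.ofReal_add (by positivity) (by positivity)]
        apply ENNReal.ofReal_le_ofReal
        have := dist_nonneg (x := z.2.1) (y := z.2.2)
        nlinarith [sq_nonneg (dist z.2.1 z.1 - dist z.1 z.2.2)]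
    have hint := lintegral_mono_ae hpt
    have hEm' : MeasurableSet ((Prod.fst : X × X × X → X) ⁻¹' E) := measurable_fst hEm
    rw [lintegral_add_right _ (by fun_prop), lintegral_const_mul _ (measurable_one.indicator hEm'),
      lintegral_indicator_one hEm', lintegral_add_right _ (by fun_prop),
      lintegral_const_mul _ (by fun_prop), lintegral_const_mul _ (by fun_prop)] at hint
    have hνE : π (Prod.fst ⁻¹' E) = ν E := by
      rw [← et, Measure.map_apply measurable_fst hEm]
    rw [hνE] at hint
    have h4 : ENNReal.ofReal (δ ^ 2) * ν E + I ≤ 4 * η + I := by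
      calc _ ≤ _ := by gcongr
        _ ≤ _ := hint
        _ ≤ 2 * (I / 4 + η) + 2 * (I / 4 + η) := by gcongr
        _ = 4 * η + 4 * (I / 4) := by ring
        _ = 4 * η + I := by rw [ENNReal.mul_div_cancel (by norm_num) (by norm_num)]
    exact (ENNReal.add_le_add_iff_right hIfin).1 h4
  have hz : ENNReal.ofReal (δ ^ 2) * ν E = 0 := by
    by_contra hne0
    have hpos : 0 < ENNReal.ofReal (δ ^ 2) * ν E := pos_iff_ne_zero.2 hne0
    have hfin' : ENNReal.ofReal (δ ^ 2) * ν E ≠ ⊤ := by finiteness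
    have h8 := key (ENNReal.ofReal (δ ^ 2) * ν E / 8) (ENNReal.div_pos hne0 (by norm_num))
    generalize ENNReal.ofReal (δ ^ 2) * ν E = t at h8 hfin' hpos
    lift t to ℝ≥0 using hfin'
    rw [show (8 : ℝ≥0∞) = ((8 : ℝ≥0) : ℝ≥0∞) by norm_num,
      show (4 : ℝ≥0∞) = ((4 : ℝ≥0) : ℝ≥0∞) by norm_num,
      ← ENNReal.coe_div (by norm_num), ← ENNReal.coe_mul, ENNReal.coe_le_coe] at h8
    have hp : 0 < t := by exact_mod_cast hpos
    rw [← NNReal.coe_le_coe] at h8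
    push_cast at h8
    have hp' : (0 : ℝ) < t := hp
    linarith
  have hE0 : ν E = 0 := by
    rcases mul_eq_zero.1 hz with h | h
    · rw [ENNReal.ofReal_eq_zero] at h
      nlinarith [sq_pos_of_pos hδ]
    · exact h
  rw [ae_iff]
  convert hE0 using 2
  ext z
  simp only [Set.mem_ofPred_eq, hE, not_and_or, not_exists, not_lt]
  simp only [imp_iff_not_or]

/-- Jensen's inequality for the probability `μ`, in the form that the `L¹` norm of `ρ ^ (-1/N)` is
at most its `Lᴺ` norm; moreover `∫ ρ⁻¹ dμ ≤ m E` because `ρ ρ⁻¹ ≤ 1`. -/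
theorem negRenyi_le {N : ℝ} (hN : 1 ≤ N) {m μ : Measure X} [SigmaFinite m]
    [IsProbabilityMeasure μ] (hμ : μ ≪ m) {E : Set X} (hE : MeasurableSet E)
    (hμE : ∀ᵐ z ∂μ, z ∈ E) : negRenyi N m μ ≤ m E ^ (1 / N) := by
  have hN0 : 0 < N := by linarith
  set ρ := μ.rnDeriv m with hρ
  have hρm : Measurable ρ := Measure.measurable_rnDeriv _ _
  have h1 : ∫⁻ x, (ρ x)⁻¹ ∂μ ≤ m E := by
    have hr : μ = (m.withDensity ρ).restrict E := by
      rw [Measure.withDensity_rnDeriv_eq _ _ hμ, Measure.restrict_eq_self_of_ae_mem hμE]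
    calc ∫⁻ x, (ρ x)⁻¹ ∂μ = ∫⁻ x, (ρ x)⁻¹ ∂((m.withDensity ρ).restrict E) := by rw [← hr]
      _ = ∫⁻ x in E, ρ x * (ρ x)⁻¹ ∂m := by
        rw [restrict_withDensity hE, lintegral_withDensity_eq_lintegral_mul (g := fun x => (ρ x)⁻¹) _ hρm
          hρm.inv]
        rfl
      _ ≤ ∫⁻ x in E, 1 ∂m := lintegral_mono fun x => ENNReal.mul_inv_le_one _
      _ = m E := by simp
  have h2 := eLpNorm'_le_eLpNorm'_of_exponent_le (p := 1) (q := N) one_pos hN μ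
    (f := fun x => ρ x ^ (-1 / N)) (hρm.pow_const _).aestronglyMeasurable
  simp only [eLpNorm', enorm_eq_self, ENNReal.rpow_one, one_div_one] at h2
  refine h2.trans (ENNReal.rpow_le_rpow ?_ (by positivity))
  refine le_trans (le_of_eq ?_) h1
  refine lintegral_congr fun x => ?_
  rw [← ENNReal.rpow_mul, div_mul_cancel₀ _ hN0.ne', ENNReal.rpow_neg_one]

theorem W2_ne_top {μ ν : Measure X} (hμ : IsProbabilityMeasure μ) (hν : IsProbabilityMeasure ν)
    {A B : Set X} (hA : ∀ᵐ z ∂μ, z ∈ A) (hB : ∀ᵐ z ∂ν, z ∈ B) {L : ℝ}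
    (hL : ∀ a ∈ A, ∀ b ∈ B, dist a b ≤ L) : W2 μ ν ≠ ⊤ := by
  have hc : IsCoupling μ ν (μ.prod ν) := by
    constructor
    · exact Measure.fst_prod
    · exact Measure.snd_prod
  have h1 : transportCost (μ.prod ν) ≤ ENNReal.ofReal L ^ 2 := by
    have hp : ∀ᵐ z ∂(μ.prod ν), z.1 ∈ A ∧ z.2 ∈ B := by
      exact (Measure.quasiMeasurePreserving_fst.ae hA).and
        (Measure.quasiMeasurePreserving_snd.ae hB)
    calc transportCost (μ.prod ν) ≤ ∫⁻ z, ENNReal.ofReal L ^ 2 ∂(μ.prod ν) := by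
          refine lintegral_mono_ae ?_
          filter_upwards [hp] with z hz
          rw [edist_dist]
          gcongr
          exact hL _ hz.1 _ hz.2
      _ = ENNReal.ofReal L ^ 2 := by simp
  intro h
  have h2 := (W2_sq_le hc).trans h1
  rw [h] at h2
  simp at h2

namespace IsRCDStar

variable {K N : ℝ} {m : Measure X}

/-- The midpoint of the uniform measures on two balls: where it is concentrated, and a lower bound
for the measure of every set carrying it. -/
theorem exists_midpoint_measure (h : IsRCDStar K N m) (x y : X) {r s δ : ℝ} (hr : 0 < r)
    (hs : 0 < s) (hδ : 0 < δ) :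
    ∃ ν : Measure X, IsProbabilityMeasure ν ∧
      (∀ᵐ z ∂ν, dist x z < r + (dist x y + r + s) / 2 + δ ∧
        dist z y < s + (dist x y + r + s) / 2 + δ) ∧
      ∀ E : Set X, MeasurableSet E → (∀ᵐ z ∂ν, z ∈ E) →
        ENNReal.ofReal (1 / (2 * Real.cosh ((dist x y + r + s) * √(-K / N) / 2))) *
          m (ball y s) ^ (1 / N) ≤ m E ^ (1 / N) := by
  have := h.sigmaFinite
  set A := ball x r
  set B := ball y s
  set L := dist x y + r + s with hLdef
  have hA0 : m A ≠ 0 := (h.fullSupport x r hr).ne'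
  have hB0 : m B ≠ 0 := (h.fullSupport y s hs).ne'
  have hAm : MeasurableSet A := measurableSet_ball
  have hBm : MeasurableSet B := measurableSet_ball
  have hA := memPInfty_cond hA0 (h.ball_lt_top x r).ne hAm isBounded_ball
  have hB := memPInfty_cond hB0 (h.ball_lt_top y s).ne hBm isBounded_ball
  obtain ⟨q, Γ, hq, hΓ, hcd⟩ := h.cdStar _ _ hA hB
  set μ₀ := ProbabilityTheory.cond m A
  set μ₁ := ProbabilityTheory.cond m B
  have := hA.1
  have := hB.1
  have aA : ∀ᵐ z ∂μ₀, z ∈ A := ProbabilityTheory.ae_cond_mem hAm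
  have aB : ∀ᵐ z ∂μ₁, z ∈ B := ProbabilityTheory.ae_cond_mem hBm
  have hhalf : (1 / 2 : ℝ) ∈ Set.Icc (0 : ℝ) 1 := by constructor <;> norm_num
  have hΓ2 := hΓ.2.2.1 _ hhalf
  have := hΓ2.1
  have hL : ∀ a ∈ A, ∀ b ∈ B, dist a b ≤ L := by
    intro a ha b hb
    have h1 := dist_triangle4 a x y b
    have h2 : dist a x < r := ha
    have h3 : dist b y < s := hb
    rw [dist_comm y b] at h1
    linarith
  have hsq : ∀ w : ℝ≥0∞, (ENNReal.ofReal (1 / 2) * w) ^ 2 = w ^ 2 / 4 := by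
    intro w
    have e : ENNReal.ofReal (1 / 2) ^ 2 = (4 : ℝ≥0∞)⁻¹ := by
      rw [← ENNReal.ofReal_pow (by norm_num), show (4 : ℝ≥0∞) = ENNReal.ofReal 4 by simp,
        ← ENNReal.ofReal_inv_of_pos (by norm_num)]
      norm_num
    rw [mul_pow, e, mul_comm, div_eq_mul_inv]
  have w0 : W2 μ₀ (Γ (1 / 2)) ^ 2 = W2 μ₀ μ₁ ^ 2 / 4 := by
    have := hΓ.2.2.2 0 (by simp) _ hhalf
    rw [hΓ.1] at this
    rw [this, ← hsq]
    norm_num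
  have w1 : W2 (Γ (1 / 2)) μ₁ ^ 2 = W2 μ₀ μ₁ ^ 2 / 4 := by
    have := hΓ.2.2.2 _ hhalf 1 (by simp)
    rw [hΓ.2.1] at this
    rw [this, ← hsq]
    norm_num
  have hmid := wasserstein_midpoint_ae hAm hBm aA aB hδ hL w0 w1
    (W2_ne_top hA.1 hB.1 aA aB hL)
  refine ⟨Γ (1 / 2), hΓ2.1, ?_, ?_⟩
  · filter_upwards [hmid] with z hz
    obtain ⟨⟨a, ha, haz⟩, b, hb, hzb⟩ := hz
    have h2 : dist a x < r := ha
    have h3 : dist b y < s := hb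
    have h4 := dist_triangle x a z
    have h5 := dist_triangle z b y
    rw [dist_comm x a] at h4
    constructor <;> linarith
  · intro E hE hEae
    refine le_trans ?_ (negRenyi_le h.one_le hΓ2.2.1 hE hEae)
    refine le_trans ?_ (hcd _ hhalf N le_rfl)
    have hqp := hq.1.isProbabilityMeasure
    have q1 : ∀ᵐ z ∂q, z.1 ∈ A := by
      have := aA
      rw [← hq.1.1] at this
      exact ae_of_ae_map (by fun_prop) this
    have q2 : ∀ᵐ z ∂q, z.2 ∈ B := by
      have := aB
      rw [← hq.1.2] at this
      exact ae_of_ae_map (by fun_prop) this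
    have q3 : ∀ᵐ z ∂q, μ₁.rnDeriv m z.2 = (m B)⁻¹ := by
      have : ∀ᵐ z ∂μ₁, μ₁.rnDeriv m z = (m B)⁻¹ := ae_cond_rnDeriv hBm
      rw [← hq.1.2] at this
      have := ae_of_ae_map (by fun_prop) this
      rwa [hq.1.2] at this
    calc _ = ∫⁻ _, ENNReal.ofReal (1 / (2 * Real.cosh (L * √(-K / N) / 2))) *
          m B ^ (1 / N) ∂q := by simp
      _ ≤ _ := by
        -- Only the term of `μ₁` is kept, so the radius of the ball around `x` enters only through
        -- `L` and may be taken small.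
        refine lintegral_mono_ae ?_
        filter_upwards [q1, q2, q3] with z h1 h2 h3
        refine le_trans ?_ le_add_self
        have e : m B ^ (1 / N) = μ₁.rnDeriv m z.2 ^ (-1 / N) := by
          rw [h3, ENNReal.inv_rpow, ← ENNReal.rpow_neg, neg_div, neg_neg]
        rw [e]
        gcongr
        exact le_sigmaCoeff_half h.one_le dist_nonneg (hL _ h1 _ h2)

/-- Existence of approximate midpoints. -/
theorem exists_approx_midpoint (h : IsRCDStar K N m) (x y : X) {ε : ℝ} (hε : 0 < ε) :
    ∃ z, dist x z ≤ dist x y / 2 + ε ∧ dist z y ≤ dist x y / 2 + ε := by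
  obtain ⟨ν, hν, hz, -⟩ := h.exists_midpoint_measure x y (r := ε / 4) (s := ε / 4) (δ := ε / 4)
    (by positivity) (by positivity) (by positivity)
  obtain ⟨z, h1, h2⟩ := hz.exists
  exact ⟨z, by linarith, by linarith⟩

/-- A local volume comparison between balls of radii `R` and `3 R / 4`. -/
theorem exists_measure_ball_le (K N : ℝ) {R : ℝ} (hR : 0 < R) :
    ∃ C : ℝ≥0, ∀ {X : Type u} [MetricSpace X] [MeasurableSpace X] [ProperSpace X] [BorelSpace X]
      {m : Measure X}, IsRCDStar K N m → ∀ x, m (ball x R) ≤ C * m (ball x (3 / 4 * R)) := by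
  set c : ℝ := 1 / (2 * Real.cosh ((R / 16 + R) * √(-K / N) / 2)) with hc
  have hc0 : 0 < c := by positivity
  refine ⟨(c⁻¹ ^ N).toNNReal, ?_⟩
  intro X _ _ _ _ m h x
  have hN0 : 0 < N := lt_of_lt_of_le one_pos h.one_le
  -- Midpoints between `ball x (R / 16)` and `ball x R` lie within `R/16 + 17R/32 + R/16 = 21R/32`
  -- of `x`, hence inside the ball of radius `3R/4`.
  obtain ⟨ν, hν, hz, hE⟩ := h.exists_midpoint_measure x x (r := R / 16) (s := R) (δ := R / 16)
    (by positivity) hR (by positivity)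
  have h1 := hE (ball x (3 / 4 * R)) measurableSet_ball (by
    filter_upwards [hz] with z hz
    rw [mem_ball, dist_comm]
    have := hz.1
    rw [dist_self] at this
    linarith)
  rw [dist_self, zero_add, ← hc] at h1
  have h2 := ENNReal.rpow_le_rpow h1 hN0.le
  rw [ENNReal.mul_rpow_of_nonneg _ _ hN0.le, ← ENNReal.rpow_mul, ← ENNReal.rpow_mul,
    one_div_mul_cancel hN0.ne', ENNReal.rpow_one, ENNReal.rpow_one,
    ENNReal.ofReal_rpow_of_nonneg hc0.le hN0.le] at h2
  calc m (ball x R) = ENNReal.ofReal (c⁻¹ ^ N) * (ENNReal.ofReal (c ^ N) * m (ball x R)) := by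
        rw [← mul_assoc, ← ENNReal.ofReal_mul (by positivity),
          ← Real.mul_rpow (by positivity) hc0.le, inv_mul_cancel₀ hc0.ne']
        simp
    _ ≤ ENNReal.ofReal (c⁻¹ ^ N) * m (ball x (3 / 4 * R)) := by gcongr

/-- A uniform volume comparison between balls of two given radii. -/
theorem exists_measure_ball_le_measure_ball (K N : ℝ) {R r : ℝ} (hr : 0 < r) :
    ∃ C : ℝ≥0, ∀ {X : Type u} [MetricSpace X] [MeasurableSpace X] [ProperSpace X] [BorelSpace X]
      {m : Measure X}, IsRCDStar K N m → ∀ x, m (ball x R) ≤ C * m (ball x r) := by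
  rcases le_or_gt R 0 with hR | hR
  · exact ⟨0, fun _ x => by simp [ball_eq_empty.2 hR]⟩
  have step : ∀ j : ℕ, ∃ C : ℝ≥0, ∀ {X : Type u} [MetricSpace X] [MeasurableSpace X]
      [ProperSpace X] [BorelSpace X] {m : Measure X}, IsRCDStar K N m →
        ∀ x, m (ball x R) ≤ C * m (ball x ((3 / 4) ^ j * R)) := by
    intro j
    induction j with
    | zero => exact ⟨1, fun _ x => by simp⟩
    | succ j ih =>
      obtain ⟨C, hC⟩ := ih
      obtain ⟨D, hD⟩ := exists_measure_ball_le K N (R := (3 / 4) ^ j * R) (by positivity)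
      refine ⟨C * D, fun {X} _ _ _ _ m h x => (hC h x).trans ?_⟩
      have := hD h x
      rw [← mul_assoc, ← pow_succ'] at this
      rw [ENNReal.coe_mul, mul_assoc]
      gcongr
  obtain ⟨j, hj⟩ := exists_pow_lt_of_lt_one (div_pos hr hR) (by norm_num : (3 / 4 : ℝ) < 1)
  obtain ⟨C, hC⟩ := step j
  refine ⟨C, fun {X} _ _ _ _ m h x => (hC h x).trans ?_⟩
  gcongr
  exact ((lt_div_iff₀ hR).1 hj).le

end IsRCDStar

end Transport

/-! ### Diagonal sequences -/

section Diagonal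

theorem exists_tendsto_eventually {P : ℕ → ℕ → Prop} (h : ∀ k, ∀ᶠ i in atTop, P k i) :
    ∃ κ : ℕ → ℕ, Tendsto κ atTop atTop ∧ ∀ᶠ i in atTop, P (κ i) i := by
  classical
  choose n hn using fun k => eventually_atTop.1 (h k)
  -- `κ i` is the largest `k ≤ i` whose threshold has been passed; once `i ≥ n 0` the value `k = 0`
  -- qualifies, so the maximum is genuine.
  refine ⟨fun i => Nat.findGreatest (fun k => n k ≤ i) i, ?_, ?_⟩
  · refine tendsto_atTop.2 fun k => ?_
    filter_upwards [eventually_ge_atTop (max k (n k))] with i hi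
    exact Nat.le_findGreatest (le_of_max_le_left hi) (le_of_max_le_right hi)
  · filter_upwards [eventually_ge_atTop (n 0)] with i hi
    exact hn _ i (Nat.findGreatest_spec (P := fun k => n k ≤ i) (Nat.zero_le i) hi)

theorem exists_seq_of_forall_pos {X : ℕ → Type*} [∀ i, Nonempty (X i)]
    {P : ℝ → ∀ i, X i → Prop} (h : ∀ ε > 0, ∀ᶠ i in atTop, ∃ x, P ε i x) :
    ∃ (a : ∀ i, X i) (ε : ℕ → ℝ), (∀ i, 0 < ε i) ∧ Tendsto ε atTop (𝓝 0) ∧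
      ∀ᶠ i in atTop, P (ε i) i (a i) := by
  classical
  obtain ⟨κ, hκ, hP⟩ := exists_tendsto_eventually
    (P := fun k i => ∃ x, P (1 / ((k : ℝ) + 1)) i x) fun k => h _ (by positivity)
  refine ⟨fun i => Classical.epsilon fun x => P (1 / ((κ i : ℝ) + 1)) i x,
    fun i => 1 / ((κ i : ℝ) + 1), fun i => by positivity,
    tendsto_one_div_add_atTop_nhds_zero_nat.comp hκ, ?_⟩
  filter_upwards [hP] with i hi
  exact Classical.epsilon_spec hi

end Diagonal

/-! ### Gromov–Hausdorff approximations and lifts of limit points -/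

section GHMap

variable {X : ℕ → Type*} [∀ i, MetricSpace (X i)] {X' : Type*} [MetricSpace X']

/-- The points `a i` stay at bounded distance from `p i` and converge to `y`. -/
def Lifts (p : ∀ i, X i) (Φ : ∀ i, X i → X') (a : ∀ i, X i) (y : X') : Prop :=
  (∃ R, ∀ᶠ i in atTop, a i ∈ ball (p i) R) ∧ Tendsto (fun i => Φ i (a i)) atTop (𝓝 y)

/-- Gromov--Hausdorff approximations with values in the limit space. -/
structure IsGHMap (p : ∀ i, X i) (p' : X') (Φ : ∀ i, X i → X') : Prop where
  base : Tendsto (fun i => Φ i (p i)) atTop (𝓝 p')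
  dist_le : ∀ R ε : ℝ, 0 < ε → ∀ᶠ i in atTop, ∀ x ∈ ball (p i) R, ∀ y ∈ ball (p i) R,
    |dist (Φ i x) (Φ i y) - dist x y| ≤ ε
  lift : ∀ y, ∃ a, Lifts p Φ a y

theorem abs_toReal_sub_le {a b : ℝ≥0∞} (ha : a ≠ ⊤) (hb : b ≠ ⊤) {ε : ℝ}
    (hε : 0 ≤ ε) (h : absDiff a b ≤ ENNReal.ofReal ε) : |a.toReal - b.toReal| ≤ ε := by
  lift a to ℝ≥0 using ha
  lift b to ℝ≥0 using hb
  rw [absDiff, ← ENNReal.coe_sub, ← ENNReal.coe_sub, ← ENNReal.coe_add, ENNReal.ofReal,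
    ENNReal.coe_le_coe] at h
  have h' : (a : ℝ) - b ≤ ((a - b + (b - a) : ℝ≥0) : ℝ) ∧
      (b : ℝ) - a ≤ ((a - b + (b - a) : ℝ≥0) : ℝ) := by
    push_cast
    have h1 : (a : ℝ) - b ≤ ((a - b : ℝ≥0) : ℝ) := by
      rw [NNReal.coe_sub_def]; exact le_max_left _ _
    have h2 : (b : ℝ) - a ≤ ((b - a : ℝ≥0) : ℝ) := by
      rw [NNReal.coe_sub_def]; exact le_max_left _ _
    have h3 := (a - b).coe_nonneg
    have h4 := (b - a).coe_nonneg
    constructor <;> linarith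
  rw [← NNReal.coe_le_coe, Real.coe_toNNReal _ hε] at h
  simp only [ENNReal.coe_toReal]
  rw [abs_le]
  constructor <;> linarith

theorem absDiff_le_iSup₂ {Z Y : Type*} [MetricSpace Z] [MetricSpace Y] (φ : Z → Option Y)
    {s : Set Z} {x y : Z} (hx : x ∈ s) (hy : y ∈ s) :
    absDiff (extDist (φ x) (φ y)) (edist x y) ≤
      ⨆ x₁ ∈ s, ⨆ x₂ ∈ s, absDiff (extDist (φ x₁) (φ x₂)) (edist x₁ x₂) :=
  le_trans (le_iSup₂ (f := fun z (_ : z ∈ s) => absDiff (extDist (φ x) (φ z)) (edist x z)) y hy)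
    (le_iSup₂ (f := fun w (_ : w ∈ s) =>
      ⨆ z ∈ s, absDiff (extDist (φ w) (φ z)) (edist w z)) x hx)

/-- The base point goes to a genuine point of the limit, so sending a point of a bounded ball to `∗`
would make the distortion infinite. Hence the default value in `getD` is eventually irrelevant on
bounded balls. -/
theorem IsGHApprox.eventually_eq_some {p : ∀ i, X i} {p' : X'} {φ : ∀ i, X i → Option X'}
    (h : IsGHApprox p p' φ) (R : ℝ) :
    ∀ᶠ i in atTop, ∀ x ∈ ball (p i) R, φ i x = some ((φ i x).getD p') := by
  have hR : 0 < max R 1 := by positivity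
  have hb := h.base.eventually (gt_mem_nhds one_pos)
  have hd := (h.distortion _ hR).eventually (gt_mem_nhds one_pos)
  filter_upwards [hb, hd] with i hbi hdi x hx
  have hx2 : x ∈ ball (p i) (2 * max R 1) :=
    ball_subset_ball (by have := le_max_left R 1; linarith) hx
  have hp2 : p i ∈ ball (p i) (2 * max R 1) := mem_ball_self (by positivity)
  have h1 : absDiff (extDist (φ i x) (φ i (p i))) (edist x (p i)) < 1 :=
    (absDiff_le_iSup₂ (φ i) hx2 hp2).trans_lt hdi
  cases hφ : φ i x with
  | some z => rfl
  | none =>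
    exfalso
    cases hφp : φ i (p i) with
    | none =>
      rw [hφp] at hbi
      simp [extDist] at hbi
    | some w =>
      rw [hφ, hφp] at h1
      simp [extDist, absDiff, ENNReal.top_sub (edist_ne_top x (p i))] at h1

theorem IsGHApprox.isGHMap {p : ∀ i, X i} {p' : X'} {φ : ∀ i, X i → Option X'}
    (h : IsGHApprox p p' φ) : IsGHMap p p' fun i x => (φ i x).getD p' where
  base := by
    rw [tendsto_iff_edist_tendsto_0]
    refine h.base.congr' ?_
    filter_upwards [h.eventually_eq_some 1] with i hi
    conv_lhs => rw [hi (p i) (mem_ball_self one_pos)]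
    rfl
  dist_le := by
    intro R ε hε
    have hR : 0 < max R 1 := by positivity
    have hd := (h.distortion _ hR).eventually (gt_mem_nhds (ENNReal.ofReal_pos.2 hε))
    filter_upwards [hd, h.eventually_eq_some R] with i hdi hs x hx y hy
    have hsub : ball (p i) R ⊆ ball (p i) (2 * max R 1) :=
      ball_subset_ball (by have := le_max_left R 1; linarith)
    have h1 : absDiff (extDist (φ i x) (φ i y)) (edist x y) < ENNReal.ofReal ε :=
      (absDiff_le_iSup₂ (φ i) (hsub hx) (hsub hy)).trans_lt hdi
    rw [hs x hx, hs y hy] at h1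
    have := abs_toReal_sub_le (edist_ne_top _ _) (edist_ne_top _ _) hε.le h1.le
    rwa [edist_dist, edist_dist, ENNReal.toReal_ofReal dist_nonneg,
      ENNReal.toReal_ofReal dist_nonneg] at this
  lift := by
    intro y
    have : ∀ i, Nonempty (X i) := fun i => ⟨p i⟩
    set R := dist y p' + 1 with hR
    have hR0 : 0 < R := by positivity
    have hy : y ∈ ball p' R := by simp [hR]
    have key : ∀ ε > 0, ∀ᶠ i in atTop, ∃ x : X i, x ∈ ball (p i) (2 * R) ∧
        dist ((φ i x).getD p') y < ε := by
      intro ε hε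
      have hd := (h.dense R hR0).eventually (gt_mem_nhds (ENNReal.ofReal_pos.2 hε))
      filter_upwards [hd, h.eventually_eq_some (2 * R)] with i hi hs
      have h1 : ⨅ x ∈ ball (p i) (2 * R), extDist (φ i x) (some y) < ENNReal.ofReal ε :=
        lt_of_le_of_lt
          (le_iSup₂ (f := fun z (_ : z ∈ ball p' R) =>
            ⨅ x ∈ ball (p i) (2 * R), extDist (φ i x) (some z)) y hy) hi
      simp only [iInf_lt_iff] at h1
      obtain ⟨x, hx, hxε⟩ := h1
      refine ⟨x, hx, ?_⟩
      rw [hs x hx] at hxε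
      have : edist ((φ i x).getD p') y < ENNReal.ofReal ε := hxε
      rwa [edist_dist, ENNReal.ofReal_lt_ofReal_iff hε] at this
    obtain ⟨a, ε, -, hε, ha⟩ := exists_seq_of_forall_pos
      (P := fun ε i (x : X i) => x ∈ ball (p i) (2 * R) ∧ dist ((φ i x).getD p') y < ε) key
    refine ⟨a, ⟨2 * R, ha.mono fun i hi => hi.1⟩, ?_⟩
    rw [tendsto_iff_dist_tendsto_zero]
    exact squeeze_zero' (Eventually.of_forall fun _ => dist_nonneg)
      (ha.mono fun i hi => hi.2.le) hε

variable {p : ∀ i, X i} {p' : X'} {Φ : ∀ i, X i → X'} {a b : ∀ i, X i} {y z : X'}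

theorem Lifts.subseq (h : Lifts p Φ a y) {k : ℕ → ℕ} (hk : StrictMono k) :
    Lifts (fun i => p (k i)) (fun i => Φ (k i)) (fun i => a (k i)) y :=
  ⟨h.1.imp fun _ hR => hk.tendsto_atTop.eventually hR, h.2.comp hk.tendsto_atTop⟩

theorem IsGHMap.subseq (h : IsGHMap p p' Φ) {k : ℕ → ℕ} (hk : StrictMono k) :
    IsGHMap (fun i => p (k i)) p' (fun i => Φ (k i)) where
  base := h.base.comp hk.tendsto_atTop
  dist_le R ε hε := hk.tendsto_atTop.eventually (h.dist_le R ε hε)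
  lift y := (h.lift y).imp' (fun a i => a (k i)) fun _ ha => ha.subseq hk

theorem IsGHMap.tendsto_dist_sub (h : IsGHMap p p' Φ) {R : ℝ}
    (ha : ∀ᶠ i in atTop, a i ∈ ball (p i) R) (hb : ∀ᶠ i in atTop, b i ∈ ball (p i) R) :
    Tendsto (fun i => dist (Φ i (a i)) (Φ i (b i)) - dist (a i) (b i)) atTop (𝓝 0) := by
  rw [Metric.tendsto_nhds]
  intro ε hε
  filter_upwards [h.dist_le R (ε / 2) (by positivity), ha, hb] with i hi hai hbi
  rw [Real.dist_0_eq_abs]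
  linarith [hi _ hai _ hbi]

theorem eventually_mem_ball_max {R S : ℝ} (ha : ∀ᶠ i in atTop, a i ∈ ball (p i) R) :
    ∀ᶠ i in atTop, a i ∈ ball (p i) (max R S) :=
  ha.mono fun _ hi => ball_subset_ball (le_max_left _ _) hi

theorem Lifts.tendsto_dist (h : IsGHMap p p' Φ) (ha : Lifts p Φ a y) (hb : Lifts p Φ b z) :
    Tendsto (fun i => dist (a i) (b i)) atTop (𝓝 (dist y z)) := by
  obtain ⟨⟨R, hR⟩, ha'⟩ := ha
  obtain ⟨⟨S, hS⟩, hb'⟩ := hb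
  have h1 := h.tendsto_dist_sub (eventually_mem_ball_max (S := S) hR)
    (by rw [max_comm]; exact eventually_mem_ball_max hS)
  simpa using (ha'.dist hb').sub h1

theorem Lifts.of_tendsto_dist (h : IsGHMap p p' Φ) (ha : Lifts p Φ a y)
    (hab : Tendsto (fun i => dist (a i) (b i)) atTop (𝓝 0)) : Lifts p Φ b y := by
  obtain ⟨⟨R, hR⟩, ha'⟩ := ha
  have hb : ∀ᶠ i in atTop, b i ∈ ball (p i) (R + 1) := by
    filter_upwards [hR, hab.eventually (gt_mem_nhds one_pos)] with i h1 h2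
    rw [mem_ball] at h1 ⊢
    linarith [dist_triangle_left (b i) (p i) (a i)]
  have hR' : ∀ᶠ i in atTop, a i ∈ ball (p i) (R + 1) :=
    hR.mono fun _ hi => ball_subset_ball (by linarith) hi
  refine ⟨⟨R + 1, hb⟩, ?_⟩
  have h1 := (h.tendsto_dist_sub hR' hb).add hab
  simp only [sub_add_cancel, add_zero] at h1
  rw [tendsto_iff_dist_tendsto_zero] at ha' ⊢
  refine squeeze_zero (fun _ => dist_nonneg) (fun i => dist_triangle_left _ _ (Φ i (a i))) ?_
  simpa using h1.add ha'

theorem IsGHMap.eventually_mem_closedBall (h : IsGHMap p p' Φ) {R : ℝ}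
    (ha : ∀ᶠ i in atTop, a i ∈ ball (p i) R) :
    ∀ᶠ i in atTop, Φ i (a i) ∈ closedBall p' (R + 2) := by
  have h1 := (tendsto_iff_dist_tendsto_zero.1 h.base).eventually (gt_mem_nhds one_pos)
  filter_upwards [ha, h1, h.dist_le (max R 1) 1 one_pos] with i h2 h3 h4
  have h5 := (abs_le.1 (h4 _ (ball_subset_ball (le_max_left _ _) h2) (p i)
    (mem_ball_self (by positivity)))).2
  rw [mem_ball] at h2
  rw [mem_closedBall]
  linarith [dist_triangle (Φ i (a i)) (Φ i (p i)) p']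

theorem IsGHMap.exists_subseq_lifts [ProperSpace X'] (h : IsGHMap p p' Φ) {R : ℝ}
    (ha : ∀ᶠ i in atTop, a i ∈ ball (p i) R) :
    ∃ k : ℕ → ℕ, StrictMono k ∧ ∃ y,
      Lifts (fun i => p (k i)) (fun i => Φ (k i)) (fun i => a (k i)) y := by
  obtain ⟨y, -, k, hk, hy⟩ := (isCompact_closedBall p' (R + 2)).tendsto_subseq'
    (h.eventually_mem_closedBall ha).frequently
  exact ⟨k, hk, y, ⟨R, hk.tendsto_atTop.eventually ha⟩, hy⟩

/-- Limits of spaces with approximate midpoints have midpoints. -/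
theorem IsGHMap.exists_midpoint [ProperSpace X'] (h : IsGHMap p p' Φ)
    (hmid : ∀ i, ∀ x y : X i, ∀ ε > 0,
      ∃ z, dist x z ≤ dist x y / 2 + ε ∧ dist z y ≤ dist x y / 2 + ε) (y z : X') :
    ∃ w, dist y w ≤ dist y z / 2 ∧ dist w z ≤ dist y z / 2 := by
  obtain ⟨a, ha⟩ := h.lift y
  obtain ⟨b, hb⟩ := h.lift z
  choose c hc1 hc2 using fun i => hmid i (a i) (b i) (1 / ((i : ℝ) + 1)) (by positivity)
  have hab := ha.tendsto_dist h hb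
  have hup : Tendsto (fun i : ℕ => dist (a i) (b i) / 2 + 1 / ((i : ℝ) + 1)) atTop
      (𝓝 (dist y z / 2)) := by
    simpa using (hab.div_const 2).add tendsto_one_div_add_atTop_nhds_zero_nat
  obtain ⟨R, hR⟩ := ha.1
  have hcb : ∀ᶠ i in atTop, c i ∈ ball (p i) (R + (dist y z / 2 + 1)) := by
    filter_upwards [hR, hup.eventually (gt_mem_nhds (lt_add_one _))] with i h1 h2
    rw [mem_ball] at h1 ⊢
    linarith [dist_triangle_left (c i) (p i) (a i), hc1 i]
  obtain ⟨k, hk, w, hw⟩ := h.exists_subseq_lifts hcb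
  refine ⟨w, ?_, ?_⟩
  · exact le_of_tendsto_of_tendsto' ((ha.subseq hk).tendsto_dist (h.subseq hk) hw)
      (hup.comp hk.tendsto_atTop) fun i => hc1 (k i)
  · exact le_of_tendsto_of_tendsto' (hw.tendsto_dist (h.subseq hk) (hb.subseq hk))
      (hup.comp hk.tendsto_atTop) fun i => hc2 (k i)

/-- Compactness of a ball of the limit. The net is chosen before the lifts `c`, so it serves any
choice of them. The three errors of `δ / 4` are the net radius, the convergence of the lift and the
distortion of `Φ i`. -/
theorem IsGHMap.exists_finite_net [ProperSpace X'] (hΦ : IsGHMap p p' Φ) (R : ℝ) {δ : ℝ}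
    (hδ : 0 < δ) :
    ∃ t : Finset X', ∀ c : X' → ∀ i, X i, (∀ y ∈ t, Lifts p Φ (c y) y) →
      ∀ᶠ i in atTop, ∀ x ∈ ball (p i) R, ∃ y ∈ t, dist (Φ i x) y < δ ∧ dist x (c y i) < δ := by
  obtain ⟨t, -, htf, ht⟩ := (isCompact_closedBall p' (R + 2)).finite_cover_balls
    (show 0 < δ / 4 by positivity)
  lift t to Finset X' using htf
  refine ⟨t, fun c hc => ?_⟩
  have h1 : ∀ y ∈ t, ∀ᶠ i in atTop, dist (Φ i (c y i)) y < δ / 4 ∧ ∀ x ∈ ball (p i) R,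
      |dist (Φ i x) (Φ i (c y i)) - dist x (c y i)| ≤ δ / 4 := by
    intro y hy
    obtain ⟨S, hS⟩ := (hc y hy).1
    filter_upwards [(tendsto_iff_dist_tendsto_zero.1 (hc y hy).2).eventually
      (gt_mem_nhds (show 0 < δ / 4 by positivity)), hS,
      hΦ.dist_le (max R S) (δ / 4) (by positivity)] with i h1 h2 h3
    exact ⟨h1, fun x hx => h3 x (ball_subset_ball (le_max_left _ _) hx) _
      (ball_subset_ball (le_max_right _ _) h2)⟩
  filter_upwards [(Finset.eventually_all t).2 h1, hΦ.dist_le (max R 1) 1 one_pos,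
    (tendsto_iff_dist_tendsto_zero.1 hΦ.base).eventually (gt_mem_nhds one_pos)] with i h2 h3 h4 x hx
  have hx' : dist x (p i) < R := hx
  have h5 := (abs_le.1 (h3 x (ball_subset_ball (le_max_left _ _) hx) (p i)
    (mem_ball_self (by positivity)))).2
  have hmem : Φ i x ∈ closedBall p' (R + 2) := by
    rw [mem_closedBall]
    linarith [dist_triangle (Φ i x) (Φ i (p i)) p']
  obtain ⟨y, hy, hxy⟩ := Set.mem_iUnion₂.1 (ht hmem)
  have hxy' : dist (Φ i x) y < δ / 4 := hxy
  refine ⟨y, hy, by linarith, ?_⟩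
  have h6 := h2 y hy
  have h7 := (abs_le.1 (h6.2 x hx)).1
  linarith [dist_triangle_right (Φ i x) (Φ i (c y i)) y]

end GHMap

/-! ### Negligible sets for uniformly doubling measures -/

section Negligible

variable {X : ℕ → Type*} [∀ i, MetricSpace (X i)] [∀ i, MeasurableSpace (X i)]

/-- A sequence of uniformly locally doubling measures. -/
structure IsDoublingSeq (m : ∀ i, Measure (X i)) : Prop where
  lt_top : ∀ i x r, m i (ball x r) < ⊤
  pos : ∀ i x r, 0 < r → 0 < m i (ball x r)
  doubling : ∀ R r : ℝ, 0 < r → ∃ C : ℝ≥0, ∀ i x, m i (ball x R) ≤ C * m i (ball x r)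

/-- The measure of `E i` is negligible with respect to that of the unit ball around `p i`. -/
def Negligible (m : ∀ i, Measure (X i)) (p : ∀ i, X i) (E : ∀ i, Set (X i)) : Prop :=
  Tendsto (fun i => m i (E i) / m i (ball (p i) 1)) atTop (𝓝 0)

variable {m : ∀ i, Measure (X i)} {p : ∀ i, X i} {E E' U : ∀ i, Set (X i)} {a : ∀ i, X i}

theorem IsDoublingSeq.subseq (h : IsDoublingSeq m) (k : ℕ → ℕ) :
    IsDoublingSeq fun i => m (k i) where
  lt_top i := h.lt_top (k i)
  pos i := h.pos (k i)
  doubling R r hr := (h.doubling R r hr).imp fun _ hC i => hC (k i)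

theorem Negligible.subseq (h : Negligible m p E) {k : ℕ → ℕ} (hk : StrictMono k) :
    Negligible (fun i => m (k i)) (fun i => p (k i)) (fun i => E (k i)) :=
  Tendsto.comp h hk.tendsto_atTop

theorem Negligible.union (h : Negligible m p E) (h' : Negligible m p E') :
    Negligible m p fun i => E i ∪ E' i := by
  have h1 := Tendsto.add h h'
  rw [add_zero] at h1
  refine tendsto_of_tendsto_of_tendsto_of_le_of_le tendsto_const_nhds h1
    (fun _ => zero_le) fun i => ?_
  dsimp only
  rw [← ENNReal.add_div]
  gcongr
  exact measure_union_le _ _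

theorem Negligible.biUnion {ι : Type*} (s : Finset ι) {F : ι → ∀ i, Set (X i)}
    (h : ∀ j ∈ s, Negligible m p (F j)) : Negligible m p fun i => ⋃ j ∈ s, F j i := by
  classical
  induction s using Finset.induction_on with
  | empty => simp [Negligible]
  | insert j s hj ih =>
    simp only [Finset.set_biUnion_insert]
    exact (h j (by simp)).union (ih fun l hl => h l (by simp [hl]))

theorem IsDoublingSeq.exists_ball_le (hm : IsDoublingSeq m) (R : ℝ) {r : ℝ} (hr : 0 < r) :
    ∃ C : ℝ≥0, 0 < C ∧ ∀ i, ∀ x ∈ ball (p i) R, m i (ball (p i) 1) ≤ C * m i (ball x r) := by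
  obtain ⟨C, hC⟩ := hm.doubling (R + 1) r hr
  refine ⟨C + 1, by positivity, fun i x hx => ?_⟩
  calc m i (ball (p i) 1) ≤ m i (ball x (R + 1)) := by
        refine measure_mono (ball_subset_ball' ?_)
        rw [mem_ball, dist_comm] at hx
        linarith
    _ ≤ C * m i (ball x r) := hC i x
    _ ≤ _ := by gcongr; exact le_self_add

theorem Negligible.eventually_lt (h : Negligible m p E) (hm : IsDoublingSeq m) (C : ℝ≥0) :
    ∀ᶠ i in atTop, C * m i (E i) < m i (ball (p i) 1) := by
  -- `C + 1` replaces `C`, which may vanish, so that it can be inverted.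
  have hc : (0 : ℝ≥0∞) < ((C + 1 : ℝ≥0) : ℝ≥0∞)⁻¹ := by simp
  filter_upwards [Tendsto.eventually h (gt_mem_nhds hc)] with i hi
  rw [ENNReal.div_lt_iff (Or.inl (hm.pos _ _ _ one_pos).ne') (Or.inl (hm.lt_top _ _ _).ne)] at hi
  have h0 : ((C + 1 : ℝ≥0) : ℝ≥0∞) ≠ 0 := by
    simp
  calc C * m i (E i) ≤ ((C + 1 : ℝ≥0) : ℝ≥0∞) * m i (E i) := by
        gcongr; exact le_self_add
    _ < ((C + 1 : ℝ≥0) : ℝ≥0∞) * (((C + 1 : ℝ≥0) : ℝ≥0∞)⁻¹ * m i (ball (p i) 1)) :=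
        ENNReal.mul_lt_mul_right h0 ENNReal.coe_ne_top hi
    _ = m i (ball (p i) 1) := by
      rw [← mul_assoc, ENNReal.mul_inv_cancel h0 ENNReal.coe_ne_top, one_mul]

theorem Negligible.eventually_lt_ball (h : Negligible m p E) (hm : IsDoublingSeq m) {R r : ℝ}
    (hr : 0 < r) : ∀ᶠ i in atTop, ∀ x ∈ ball (p i) R, m i (E i) < m i (ball x r) := by
  obtain ⟨C, hC0, hC⟩ := hm.exists_ball_le (p := p) R hr
  filter_upwards [h.eventually_lt hm C] with i hi x hx
  exact lt_of_mul_lt_mul_left' (hi.trans_le (hC i x hx))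

/-- By doubling, a ball of fixed radius at bounded distance from `p i` has a definite fraction of
the unit mass, so a negligible set cannot contain it. Generic points are always produced this way.
-/
theorem Negligible.eventually_exists_notMem (h : Negligible m p E) (hm : IsDoublingSeq m)
    {R r : ℝ} (hr : 0 < r) : ∀ᶠ i in atTop, ∀ x ∈ ball (p i) R, ∃ z ∈ ball x r, z ∉ E i := by
  filter_upwards [h.eventually_lt_ball hm (R := R) hr] with i hi x hx
  by_contra! hcon
  exact (hi x hx).not_ge (measure_mono hcon)

theorem AsympFullMeasure.negligible_diff (h : AsympFullMeasure m p U) (hm : IsDoublingSeq m)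
    (hU : ∀ i, MeasurableSet (U i)) (R : ℝ) : Negligible m p fun i => ball (p i) R \ U i := by
  rcases le_or_gt R 0 with hR | hR
  · simp [Negligible, ball_eq_empty.2 hR]
  have h1 : Tendsto (fun i => m i (ball (p i) R \ U i) / m i (ball (p i) R)) atTop (𝓝 0) := by
    have h2 := ENNReal.Tendsto.sub (tendsto_const_nhds (x := (1 : ℝ≥0∞))) (h R hR)
      (Or.inl ENNReal.one_ne_top)
    rw [tsub_self] at h2
    refine h2.congr fun i => ?_
    have h0 := (hm.pos i (p i) R hR).ne'
    have ht := (hm.lt_top i (p i) R).ne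
    have e := measure_inter_add_sdiff (μ := m i) (ball (p i) R) (hU i)
    rw [Set.inter_comm] at e
    rw [← ENNReal.div_self h0 ht]
    conv_lhs => rw [← e]
    rw [e, ← ENNReal.sub_div (fun _ _ => h0)]
    congr 1
    conv_lhs => rw [← e]
    exact ENNReal.add_sub_cancel_left
      (ne_top_of_le_ne_top ht (measure_mono Set.inter_subset_right))
  obtain ⟨C, hC⟩ := hm.doubling R 1 one_pos
  have h3 : Tendsto (fun i => (C : ℝ≥0∞) * (m i (ball (p i) R \ U i) / m i (ball (p i) R))) atTop
      (𝓝 0) := by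
    simpa using ENNReal.Tendsto.const_mul h1 (Or.inr ENNReal.coe_ne_top)
  refine tendsto_of_tendsto_of_tendsto_of_le_of_le tendsto_const_nhds h3
    (fun _ => zero_le) fun i => ?_
  dsimp only
  have h0 := (hm.pos i (p i) R hR).ne'
  have ht := (hm.lt_top i (p i) R).ne
  rw [ENNReal.div_le_iff (hm.pos _ _ _ one_pos).ne' (hm.lt_top _ _ _).ne]
  calc m i (ball (p i) R \ U i)
      = m i (ball (p i) R \ U i) / m i (ball (p i) R) * m i (ball (p i) R) :=
        (ENNReal.div_mul_cancel h0 ht).symm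
    _ ≤ m i (ball (p i) R \ U i) / m i (ball (p i) R) * (C * m i (ball (p i) 1)) := by
        gcongr; exact hC i _
    _ = _ := by ring

theorem asympFullMeasure_of_negligible_diff (hm : IsDoublingSeq m)
    (hU : ∀ i, MeasurableSet (U i)) (h : ∀ R, Negligible m p fun i => ball (p i) R \ U i) :
    AsympFullMeasure m p U := by
  intro R hR
  obtain ⟨C, hC⟩ := hm.doubling 1 R hR
  have h3 : Tendsto (fun i => 1 - (C : ℝ≥0∞) *
      (m i (ball (p i) R \ U i) / m i (ball (p i) 1))) atTop (𝓝 1) := by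
    have := ENNReal.Tendsto.const_mul (h R) (Or.inr (ENNReal.coe_ne_top (r := C)))
    simpa using ENNReal.Tendsto.sub (tendsto_const_nhds (x := (1 : ℝ≥0∞))) this
      (Or.inl ENNReal.one_ne_top)
  refine tendsto_of_tendsto_of_tendsto_of_le_of_le h3 tendsto_const_nhds (fun i => ?_)
    (fun i => ENNReal.div_le_of_le_mul (by
      rw [one_mul]; exact measure_mono Set.inter_subset_right))
  dsimp only
  have h0 := (hm.pos i (p i) R hR).ne'
  have ht := (hm.lt_top i (p i) R).ne
  have h10 := (hm.pos i (p i) 1 one_pos).ne'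
  have h1t := (hm.lt_top i (p i) 1).ne
  rw [tsub_le_iff_right]
  have e := measure_inter_add_sdiff (μ := m i) (ball (p i) R) (hU i)
  rw [Set.inter_comm] at e
  rw [← ENNReal.div_self h0 ht]
  nth_rw 1 [← e]
  rw [ENNReal.add_div]
  gcongr
  rw [ENNReal.div_le_iff h0 ht]
  calc m i (ball (p i) R \ U i)
      = m i (ball (p i) R \ U i) / m i (ball (p i) 1) * m i (ball (p i) 1) :=
        (ENNReal.div_mul_cancel h10 h1t).symm
    _ ≤ m i (ball (p i) R \ U i) / m i (ball (p i) 1) * (C * m i (ball (p i) R)) := by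
        gcongr; exact hC i _
    _ = _ := by ring

end Negligible


/-! ### Points whose distance to a given point is distorted -/

section BadSet

/-- The points `b` close to `a` such that `f` distorts the distance from `a` to `b` by more
than `η`. -/
def badSet {X Y : Type*} [MetricSpace X] [MetricSpace Y] (η : ℝ) (f : X → Y) (a : X) : Set X :=
  {b | b ∈ ball a (1 / 4) ∧ η < |dist a b - dist (f a) (f b)|}

variable {X Y : Type*} [MetricSpace X] [MetricSpace Y]

theorem badSet_anti {η η' : ℝ} (h : η ≤ η') (f : X → Y) (a : X) :
    badSet η' f a ⊆ badSet η f a := fun _ hb => ⟨hb.1, h.trans_lt hb.2⟩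

theorem abs_dist_sub_le_of_notMem {η : ℝ} {f : X → Y} {a b : X} (hb : b ∉ badSet η f a)
    (hab : dist b a < 1 / 4) : |dist a b - dist (f a) (f b)| ≤ η :=
  not_lt.1 fun h => hb ⟨hab, h⟩

variable [ProperSpace X] [MeasurableSpace X] [BorelSpace X] [ProperSpace Y] [MeasurableSpace Y]
  [BorelSpace Y]

theorem measurableSet_badSet {f : X → Y} (hf : Measurable f) (η : ℝ) (a : X) :
    MeasurableSet (badSet η f a) := by
  change MeasurableSet (ball a (1 / 4) ∩ {b | η < |dist a b - dist (f a) (f b)|})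
  refine measurableSet_ball.inter (measurableSet_lt measurable_const ?_)
  have h1 : Measurable fun b => dist a b := by fun_prop
  have h2 : Measurable fun b => dist (f a) (f b) := measurable_const.dist hf
  exact (h1.sub h2).abs

theorem measurable_distortion {f : X → Y} (hf : Measurable f) :
    Measurable fun z : X × X => |dist z.1 z.2 - dist (f z.1) (f z.2)| := by
  have h1 : Measurable fun z : X × X => dist z.1 z.2 := by fun_prop
  have h2 : Measurable fun z : X × X => dist (f z.1) (f z.2) :=
    (hf.comp measurable_fst).dist (hf.comp measurable_snd)
  exact (h1.sub h2).abs

/-- Chebyshev's inequality for the mean distortion. -/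
theorem prod_measure_distortion_le {m : Measure X} [SFinite m] {f : X → Y} (hf : Measurable f)
    {B : Set X} (hB0 : m B ≠ 0) (hBf : m B ≠ ⊤) {ε η : ℝ}
    (hη : 0 < η) (hη1 : η ≤ 1)
    (h : ⨍ z in B ×ˢ B, distortion 1 f z.1 z.2 ∂(m.prod m) ≤ ε) :
    m.prod m {z | z ∈ B ×ˢ B ∧ η < |dist z.1 z.2 - dist (f z.1) (f z.2)|} ≤
      ENNReal.ofReal (ε / η) * (m B * m B) := by
  set μ := (m.prod m).restrict (B ×ˢ B) with hμ
  have huniv : μ Set.univ = m B * m B := by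
    rw [hμ, Measure.restrict_apply_univ, Measure.prod_prod]
  have hfin : IsFiniteMeasure μ := ⟨by rw [huniv]; finiteness⟩
  have hdm : Measurable fun z : X × X => distortion 1 f z.1 z.2 :=
    measurable_const.min (measurable_distortion hf)
  have hnn : ∀ z : X × X, 0 ≤ distortion 1 f z.1 z.2 := fun z => le_min zero_le_one (abs_nonneg _)
  have hint : Integrable (fun z : X × X => distortion 1 f z.1 z.2) μ := by
    refine Integrable.of_bound hdm.aestronglyMeasurable 1 (Eventually.of_forall fun z => ?_)
    rw [Real.norm_eq_abs, abs_of_nonneg (hnn z)]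
    exact min_le_left _ _
  have hpos : 0 < μ.real Set.univ := by
    rw [measureReal_def, huniv]
    exact ENNReal.toReal_pos (mul_ne_zero hB0 hB0) (by finiteness)
  have h1 := mul_meas_ge_le_integral_of_nonneg (Eventually.of_forall hnn) hint η
  rw [average_eq, smul_eq_mul, inv_mul_le_iff₀ hpos] at h
  have h2 : μ.real {z | η ≤ distortion 1 f z.1 z.2} ≤ ε / η * μ.real Set.univ := by
    rw [div_mul_eq_mul_div, le_div_iff₀ hη]
    linarith
  have h3 : m.prod m {z | z ∈ B ×ˢ B ∧ η < |dist z.1 z.2 - dist (f z.1) (f z.2)|} ≤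
      μ {z | η ≤ distortion 1 f z.1 z.2} := by
    rw [hμ, Measure.restrict_apply (measurableSet_le measurable_const hdm)]
    refine measure_mono fun z hz => ⟨?_, hz.1⟩
    -- As `η ≤ 1`, the truncation of the distortion at 1 does not hide values above `η`.
    exact le_min hη1 hz.2.le
  refine h3.trans ?_
  rw [← huniv, ← ENNReal.ofReal_toReal (measure_ne_top μ {z | η ≤ distortion 1 f z.1 z.2}),
    ← ENNReal.ofReal_toReal (measure_ne_top μ Set.univ), ← ENNReal.ofReal_mul']
  · exact ENNReal.ofReal_le_ofReal h2
  · exact ENNReal.toReal_nonneg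

end BadSet

/-! ### Lifts around which distances are almost preserved -/

section GoodLift

variable {X Y : ℕ → Type*} [∀ i, MetricSpace (X i)] [∀ i, MeasurableSpace (X i)]
  [∀ i, MetricSpace (Y i)] {X' : Type*} [MetricSpace X']

/-- `a` lifts `y`, and the maps `f i` almost preserve the distance from `a i` to most of the
points around it. -/
def GoodLift (m : ∀ i, Measure (X i)) (p : ∀ i, X i) (Φ : ∀ i, X i → X') (f : ∀ i, X i → Y i)
    (a : ∀ i, X i) (y : X') : Prop :=
  Lifts p Φ a y ∧ ∀ η > 0, Negligible m p fun i => badSet η (f i) (a i)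

variable {m : ∀ i, Measure (X i)} {p : ∀ i, X i} {p' : X'} {Φ : ∀ i, X i → X'}
  {f : ∀ i, X i → Y i} {a b : ∀ i, X i} {y z : X'}

theorem GoodLift.subseq (h : GoodLift m p Φ f a y) {k : ℕ → ℕ} (hk : StrictMono k) :
    GoodLift (fun i => m (k i)) (fun i => p (k i)) (fun i => Φ (k i)) (fun i => f (k i))
      (fun i => a (k i)) y :=
  ⟨h.1.subseq hk, fun η hη => (h.2 η hη).subseq hk⟩

/-- If every `a` in a `δ`-ball around `x i` had a bad set of mass above `δ M`, with `M` the unit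
mass, Fubini would give bad pairs of mass comparable to `M²`, against the bound `(ε i / δ) M²` up to
constants from Chebyshev. Letting `δ` tend to 0 diagonally handles all thresholds at once. -/
theorem exists_goodLift [∀ i, ProperSpace (X i)] [∀ i, BorelSpace (X i)]
    [∀ i, ProperSpace (Y i)] [∀ i, MeasurableSpace (Y i)] [∀ i, BorelSpace (Y i)]
    [∀ i, SFinite (m i)]
    (hm : IsDoublingSeq m) (hΦ : IsGHMap p p' Φ) (hf : ∀ i, Measurable (f i))
    {U : ∀ i, Set (X i)} (hU : ∀ i, MeasurableSet (U i)) (hUf : AsympFullMeasure m p U)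
    {ε : ℕ → ℝ} (hε : Tendsto ε atTop (𝓝 0))
    (hd : ∀ i, ∀ x ∈ U i, ⨍ z in ball x 1 ×ˢ ball x 1, distortion 1 (f i) z.1 z.2
      ∂((m i).prod (m i)) ≤ ε i) (y : X') :
    ∃ a, GoodLift m p Φ f a y := by
  have : ∀ i, Nonempty (X i) := fun i => ⟨p i⟩
  obtain ⟨x, hx⟩ := hΦ.lift y
  obtain ⟨R, hR⟩ := hx.1
  have key : ∀ δ > 0, ∀ᶠ i in atTop, ∃ a, dist (x i) a ≤ δ ∧
      m i (badSet δ (f i) a) ≤ ENNReal.ofReal δ * m i (ball (p i) 1) := by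
    intro δ₀ hδ₀
    obtain ⟨δ, hδ, hδ₁, hδ₂⟩ : ∃ δ > 0, δ ≤ δ₀ ∧ δ ≤ 1 / 4 :=
      ⟨min δ₀ (1 / 4), by positivity, min_le_left _ _, min_le_right _ _⟩
    obtain ⟨C, hC⟩ := hm.doubling (R + 2) 1 one_pos
    obtain ⟨D, -, hD⟩ := hm.exists_ball_le (p := p) R hδ
    have hsmall : ∀ᶠ i in atTop, D * (ε i / δ * (C * C)) < δ := by
      have : Tendsto (fun i => (D : ℝ) * (ε i / δ * (C * C))) atTop (𝓝 0) := by
        simpa using ((hε.div_const δ).mul_const ((C : ℝ) * C)).const_mul (D : ℝ)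
      exact this.eventually (gt_mem_nhds hδ)
    -- The radii `1/2` (from `x i` to `u`), `δ ≤ 1/4` (to `a`) and `1/4` (to the bad points) add up
    -- to at most 1, the scale of the distortion estimate around `u`.
    filter_upwards [hR, (hUf.negligible_diff hm hU (R + 1)).eventually_exists_notMem hm (R := R)
      (r := 1 / 2) (by norm_num), hsmall] with i hxi hUi hsi
    obtain ⟨u, hux, huU⟩ := hUi _ hxi
    have hxR : dist (x i) (p i) < R := hxi
    have hux' : dist u (x i) < 1 / 2 := hux
    have hup : dist u (p i) < R + 1 := by linarith [dist_triangle u (x i) (p i)]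
    have hu : u ∈ U i := by
      by_contra hcon
      exact huU ⟨hup, hcon⟩
    set W : Set (X i × X i) := {z | z ∈ ball u 1 ×ˢ ball u 1 ∧
      δ < |dist z.1 z.2 - dist (f i z.1) (f i z.2)|} with hW
    have hWm : MeasurableSet W := (measurableSet_ball.prod measurableSet_ball).inter
      (measurableSet_lt measurable_const (measurable_distortion (hf i)))
    have hWle : (m i).prod (m i) W ≤
        ENNReal.ofReal (ε i / δ) * (m i (ball u 1) * m i (ball u 1)) :=
      prod_measure_distortion_le (hf i) (hm.pos i u 1 one_pos).ne'
        (hm.lt_top i u 1).ne hδ (by linarith) (hd i u hu)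
    set M := m i (ball (p i) 1) with hM
    have hM0 : M ≠ 0 := (hm.pos i _ 1 one_pos).ne'
    have hMt : M ≠ ⊤ := (hm.lt_top i _ 1).ne
    have hball : m i (ball u 1) ≤ C * M :=
      (measure_mono (ball_subset_ball' (by linarith))).trans (hC i (p i))
    by_contra! hcon
    have hlow : ∀ a ∈ ball (x i) δ, ENNReal.ofReal δ * M ≤ m i (Prod.mk a ⁻¹' W) := by
      intro a ha
      have ha' : dist a (x i) < δ := ha
      have h1 := hcon a (by rw [dist_comm]; linarith)
      refine le_trans ?_ (h1.le.trans (measure_mono ?_))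
      · gcongr
      · intro b hb
        have hb1 : dist b a < 1 / 4 := hb.1
        refine ⟨⟨?_, ?_⟩, hδ₁.trans_lt hb.2⟩
        · rw [mem_ball]
          linarith [dist_triangle a (x i) u, dist_comm u (x i)]
        · rw [mem_ball]
          linarith [dist_triangle a (x i) u, dist_comm u (x i), dist_triangle b a u]
    have hint : ENNReal.ofReal δ * M * m i (ball (x i) δ) ≤ (m i).prod (m i) W := by
      rw [Measure.prod_apply hWm, ← setLIntegral_const]
      exact (setLIntegral_mono' measurableSet_ball hlow).trans (setLIntegral_le_lintegral _ _)
    have hfinal : ENNReal.ofReal δ * (M * M) ≤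
        (D * (ENNReal.ofReal (ε i / δ) * (C * C))) * (M * M) := by
      calc ENNReal.ofReal δ * (M * M)
          ≤ ENNReal.ofReal δ * (M * (D * m i (ball (x i) δ))) := by gcongr; exact hD i _ hxi
        _ = D * (ENNReal.ofReal δ * M * m i (ball (x i) δ)) := by ring
        _ ≤ D * (ENNReal.ofReal (ε i / δ) * ((C * M) * (C * M))) := by
          refine mul_le_mul' le_rfl (hint.trans (hWle.trans ?_))
          gcongr
        _ = _ := by ring
    rw [ENNReal.mul_le_mul_iff_left (mul_ne_zero hM0 hM0) (by finiteness)] at hfinal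
    have e : (D : ℝ≥0∞) * (ENNReal.ofReal (ε i / δ) * (C * C)) =
        ENNReal.ofReal (D * (ε i / δ * (C * C))) := by
      rw [ENNReal.ofReal_mul (by positivity), ENNReal.ofReal_mul' (by positivity),
        ENNReal.ofReal_mul (by positivity)]
      simp
    rw [e, ENNReal.ofReal_le_ofReal_iff'] at hfinal
    rcases hfinal with h | h <;> linarith
  obtain ⟨a, δ, hδ0, hδ, ha⟩ := exists_seq_of_forall_pos (P := fun δ i (a : X i) =>
    dist (x i) a ≤ δ ∧ m i (badSet δ (f i) a) ≤ ENNReal.ofReal δ * m i (ball (p i) 1)) key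
  refine ⟨a, hx.of_tendsto_dist hΦ ?_, fun η hη => ?_⟩
  · exact squeeze_zero' (Eventually.of_forall fun _ => dist_nonneg) (ha.mono fun i hi => hi.1) hδ
  · have h0 : Tendsto (fun i => ENNReal.ofReal (δ i)) atTop (𝓝 0) := by
      simpa using ENNReal.tendsto_ofReal hδ
    refine tendsto_of_tendsto_of_tendsto_of_le_of_le' tendsto_const_nhds h0
      (Eventually.of_forall fun _ => zero_le) ?_
    filter_upwards [ha, hδ.eventually (gt_mem_nhds hη)] with i hi hiη
    exact ENNReal.div_le_of_le_mul ((measure_mono (badSet_anti hiη.le _ _)).trans hi.2)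

/-- A point `c` within `η` of `a i`, bad for neither lift, compares the distances with error below
`4η`. The bound `1/8` keeps `c` within `1/4` of `b i`, where its bad set is defined. -/
theorem GoodLift.tendsto_dist_map (hm : IsDoublingSeq m) (hΦ : IsGHMap p p' Φ)
    (ha : GoodLift m p Φ f a y) (hb : GoodLift m p Φ f b z) (hyz : dist y z < 1 / 8) :
    Tendsto (fun i => dist (f i (a i)) (f i (b i))) atTop (𝓝 (dist y z)) := by
  have hab := ha.1.tendsto_dist hΦ hb.1
  suffices h : Tendsto (fun i => dist (f i (a i)) (f i (b i)) - dist (a i) (b i)) atTop (𝓝 0) by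
    simpa using h.add hab
  rw [Metric.tendsto_nhds]
  intro ε hε
  obtain ⟨η, hη, hη₁, hη₂⟩ : ∃ η > 0, η ≤ ε / 8 ∧ η ≤ 1 / 16 :=
    ⟨min (ε / 8) (1 / 16), by positivity, min_le_left _ _, min_le_right _ _⟩
  obtain ⟨R, hR⟩ := ha.1.1
  filter_upwards [hR, hab.eventually (gt_mem_nhds hyz),
    ((ha.2 η hη).union (hb.2 η hη)).eventually_exists_notMem hm (R := R) hη] with i hai hi hc
  obtain ⟨c, hca, hcn⟩ := hc _ hai
  have hca' : dist c (a i) < η := hca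
  rw [Set.mem_union, not_or] at hcn
  have hcb : dist c (b i) < 1 / 4 := by linarith [dist_triangle c (a i) (b i)]
  have h1 := abs_le.1 (abs_dist_sub_le_of_notMem hcn.1 (by linarith))
  have h2 := abs_le.1 (abs_dist_sub_le_of_notMem hcn.2 hcb)
  rw [Real.dist_0_eq_abs, abs_lt]
  have t1 := dist_triangle (f i (a i)) (f i c) (f i (b i))
  have t2 := dist_triangle_left (f i c) (f i (b i)) (f i (a i))
  have t3 := dist_triangle c (a i) (b i)
  have t4 := dist_triangle_left (a i) (b i) c
  rw [dist_comm (f i c)] at t1 t2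
  rw [dist_comm c (a i)] at hca' t3 t4
  rw [dist_comm c (b i)] at t3 t4
  constructor <;> linarith

/-- Repeated midpoints join `y` to `z` by a chain of jumps shorter than `1/8`; good lifts of the
chain have images at bounded mutual distance. -/
theorem GoodLift.exists_dist_map_le (hm : IsDoublingSeq m) (hΦ : IsGHMap p p' Φ)
    (hmid : ∀ y z : X', ∃ w, dist y w ≤ dist y z / 2 ∧ dist w z ≤ dist y z / 2)
    (hgood : ∀ y, ∃ a, GoodLift m p Φ f a y)
    (ha : GoodLift m p Φ f a y) (hb : GoodLift m p Φ f b z) :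
    ∃ R, ∀ᶠ i in atTop, dist (f i (a i)) (f i (b i)) ≤ R := by
  have key : ∀ (n : ℕ) (y z : X') (a b : ∀ i, X i), dist y z < 2 ^ n / 8 →
      GoodLift m p Φ f a y → GoodLift m p Φ f b z →
      ∃ R, ∀ᶠ i in atTop, dist (f i (a i)) (f i (b i)) ≤ R := by
    intro n
    induction n with
    | zero =>
      intro y z a b hyz ha hb
      rw [pow_zero] at hyz
      exact ⟨dist y z + 1, ((ha.tendsto_dist_map hm hΦ hb hyz).eventually
        (gt_mem_nhds (lt_add_one _))).mono fun _ => le_of_lt⟩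
    | succ n ih =>
      intro y z a b hyz ha hb
      obtain ⟨w, hw1, hw2⟩ := hmid y z
      obtain ⟨c, hc⟩ := hgood w
      rw [pow_succ] at hyz
      obtain ⟨R, hR⟩ := ih y w a c (by linarith) ha hc
      obtain ⟨S, hS⟩ := ih w z c b (by linarith) hc hb
      refine ⟨R + S, ?_⟩
      filter_upwards [hR, hS] with i h1 h2
      linarith [dist_triangle (f i (a i)) (f i (c i)) (f i (b i))]
  obtain ⟨n, hn⟩ := pow_unbounded_of_one_lt (8 * dist y z) (one_lt_two (α := ℝ))
  exact key n y z a b (by linarith) ha hb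

/-- `S i` has half the mass of the unit ball, so it contains a point outside the bad sets of a
finite net of good lifts. The image of that point is near `q i` and at bounded distance from the
image of a net point, hence from `f i (a i)`. -/
theorem GoodLift.exists_map_mem_ball [ProperSpace X'] (hm : IsDoublingSeq m)
    (hΦ : IsGHMap p p' Φ)
    (hmid : ∀ y z : X', ∃ w, dist y w ≤ dist y z / 2 ∧ dist w z ≤ dist y z / 2)
    (hgood : ∀ y, ∃ a, GoodLift m p Φ f a y) {q : ∀ i, Y i} {R₀ : ℝ} {S : ∀ i, Set (X i)}
    (hS : ∀ i, S i ⊆ ball (p i) 1) (hSm : ∀ i, m i (ball (p i) 1) / 2 ≤ m i (S i))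
    (hSf : ∀ i, Set.MapsTo (f i) (S i) (ball (q i) R₀)) (ha : GoodLift m p Φ f a y) :
    ∃ R, ∀ᶠ i in atTop, f i (a i) ∈ ball (q i) R := by
  obtain ⟨t, ht⟩ := hΦ.exists_finite_net 1 (show (0 : ℝ) < 1 / 8 by norm_num)
  choose c hc using hgood
  have hneg := Negligible.biUnion t (F := fun y i => badSet 1 (f i) (c y i))
    fun y _ => (hc y).2 1 one_pos
  choose B hB using fun y => GoodLift.exists_dist_map_le hm hΦ hmid (fun y => ⟨c y, hc y⟩) ha (hc y)
  obtain ⟨D, hD⟩ : ∃ D, ∀ y ∈ t, B y ≤ D := by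
    obtain ⟨D, hD⟩ := (t.image B).bddAbove
    exact ⟨D, fun y hy => hD (by simpa using ⟨y, hy, rfl⟩)⟩
  refine ⟨D + 2 + R₀, ?_⟩
  filter_upwards [ht c fun y _ => (hc y).1, hneg.eventually_lt hm 2,
    (Finset.eventually_all t).2 fun y _ => hB y] with i h1 h2 h3
  have h4 : m i (⋃ y ∈ t, badSet 1 (f i) (c y i)) < m i (S i) := by
    refine lt_of_lt_of_le ?_ (hSm i)
    rw [ENNReal.lt_div_iff_mul_lt (by simp) (by simp), mul_comm]
    exact h2
  obtain ⟨s, hs, hsn⟩ : ∃ s ∈ S i, s ∉ ⋃ y ∈ t, badSet 1 (f i) (c y i) := by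
    by_contra! hcon
    exact h4.not_ge (measure_mono hcon)
  obtain ⟨y, hy, -, hsy⟩ := h1 s (hS i hs)
  have h5 : s ∉ badSet 1 (f i) (c y i) := fun h => hsn (Set.mem_biUnion hy h)
  have h6 := abs_le.1 (abs_dist_sub_le_of_notMem h5 (by linarith))
  have h7 : dist (f i s) (q i) < R₀ := hSf i hs
  rw [dist_comm s] at hsy
  rw [mem_ball]
  linarith [dist_triangle4 (f i (a i)) (f i (c y i)) (f i s) (q i), h3 y hy, hD y hy]

end GoodLift


/-! ### Common subsequences -/

section Subsequences

/-- Countably many sequences, each eventually in a compact set, converge along a common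
subsequence. -/
theorem exists_subseq_forall_tendsto {Y : Type*} [MetricSpace Y] {u : ℕ → ℕ → Y}
    (h : ∀ j, ∃ K, IsCompact K ∧ ∀ᶠ i in atTop, u i j ∈ K) :
    ∃ k : ℕ → ℕ, StrictMono k ∧ ∀ j, ∃ l, Tendsto (fun i => u (k i) j) atTop (𝓝 l) := by
  classical
  choose K hK hu using h
  choose z hz using fun j => (hu j).exists
  -- Terms not yet in `K j` are replaced by a fixed element of `K j`, so that the whole sequence
  -- lies in a compact countable product.
  set v : ℕ → ℕ → Y := fun i j => if u i j ∈ K j then u i j else u (z j) j with hv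
  have hvK : ∀ i, v i ∈ Set.pi Set.univ K := by
    intro i j _
    simp only [hv]
    split_ifs with h
    exacts [h, hz j]
  obtain ⟨l, -, k, hk, hl⟩ := (isCompact_univ_pi hK).tendsto_subseq hvK
  refine ⟨k, hk, fun j => ⟨l j, ((tendsto_pi_nhds.1 hl) j).congr' ?_⟩⟩
  filter_upwards [hk.tendsto_atTop.eventually (hu j)] with i hi
  simp [hv, hi]

end Subsequences

/-! ### The limit map, its inverse and weak convergence -/

section LimitMap

variable {X Y : ℕ → Type*} [∀ i, MetricSpace (X i)] [∀ i, MeasurableSpace (X i)]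
  [∀ i, MetricSpace (Y i)] {X' Y' : Type*} [MetricSpace X'] [MetricSpace Y']

/-- `F` is the limit of the maps `f i`, along the good lifts `a y` of the points `y`. -/
structure IsLimitMap (m : ∀ i, Measure (X i)) (p : ∀ i, X i) (Φ : ∀ i, X i → X')
    (q : ∀ i, Y i) (Ψ : ∀ i, Y i → Y') (f : ∀ i, X i → Y i) (a : X' → ∀ i, X i)
    (F : X' → Y') : Prop where
  good : ∀ y, GoodLift m p Φ f (a y) y
  lim : ∀ y, Lifts q Ψ (fun i => f i (a y i)) (F y)

variable {m : ∀ i, Measure (X i)} {p : ∀ i, X i} {p' : X'} {Φ : ∀ i, X i → X'}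
  {q : ∀ i, Y i} {q' : Y'} {Ψ : ∀ i, Y i → Y'} {f : ∀ i, X i → Y i} {a : X' → ∀ i, X i}
  {F : X' → Y'}

theorem IsLimitMap.subseq (h : IsLimitMap m p Φ q Ψ f a F) {k : ℕ → ℕ} (hk : StrictMono k) :
    IsLimitMap (fun i => m (k i)) (fun i => p (k i)) (fun i => Φ (k i)) (fun i => q (k i))
      (fun i => Ψ (k i)) (fun i => f (k i)) (fun y i => a y (k i)) F where
  good y := (h.good y).subseq hk
  lim y := (h.lim y).subseq hk

/-- A subsequence is extracted for a countable dense set of points only. For any other point the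
images are Cauchy along it, because they stay close to those of a nearby dense point. -/
theorem exists_isLimitMap [ProperSpace X'] [ProperSpace Y'] (hm : IsDoublingSeq m)
    (hΦ : IsGHMap p p' Φ) (hΨ : IsGHMap q q' Ψ) (ha : ∀ y, GoodLift m p Φ f (a y) y)
    (hb : ∀ y, ∃ R, ∀ᶠ i in atTop, f i (a y i) ∈ ball (q i) R) :
    ∃ k : ℕ → ℕ, StrictMono k ∧ ∃ F : X' → Y',
      IsLimitMap (fun i => m (k i)) (fun i => p (k i)) (fun i => Φ (k i)) (fun i => q (k i))
        (fun i => Ψ (k i)) (fun i => f (k i)) (fun y i => a y (k i)) F := by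
  have : Nonempty X' := ⟨p'⟩
  obtain ⟨k, hk, hlim⟩ := exists_subseq_forall_tendsto
    (u := fun i j => Ψ i (f i (a (TopologicalSpace.denseSeq X' j) i))) fun j => by
      obtain ⟨R, hR⟩ := hb (TopologicalSpace.denseSeq X' j)
      exact ⟨_, isCompact_closedBall q' (R + 2), hΨ.eventually_mem_closedBall hR⟩
  have hcauchy : ∀ y, CauchySeq fun i => Ψ (k i) (f (k i) (a y (k i))) := by
    intro y
    rw [Metric.cauchySeq_iff']
    intro ε hε
    obtain ⟨η, hη, hη₁, hη₂⟩ : ∃ η > 0, η ≤ ε / 8 ∧ η ≤ 1 / 8 :=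
      ⟨min (ε / 8) (1 / 8), by positivity, min_le_left _ _, min_le_right _ _⟩
    obtain ⟨j, hj⟩ := (TopologicalSpace.denseRange_denseSeq X').exists_dist_lt y hη
    set z := TopologicalSpace.denseSeq X' j
    have h1 := (ha y).tendsto_dist_map hm hΦ (ha z) (hj.trans_le hη₂)
    obtain ⟨R, hR⟩ := hb y
    obtain ⟨S, hS⟩ := hb z
    have h2 := hΨ.tendsto_dist_sub (eventually_mem_ball_max (S := S) hR)
      (by rw [max_comm]; exact eventually_mem_ball_max hS)
    have h3 := h2.add h1
    simp only [sub_add_cancel, zero_add] at h3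
    have h4 := hk.tendsto_atTop.eventually (h3.eventually (gt_mem_nhds hj))
    obtain ⟨l, hl⟩ := hlim j
    have h5 := (tendsto_iff_dist_tendsto_zero.1 hl).eventually (gt_mem_nhds hη)
    obtain ⟨n, hn⟩ := eventually_atTop.1 (h4.and h5)
    refine ⟨n, fun i hi => ?_⟩
    obtain ⟨u1, u2⟩ := hn i hi
    obtain ⟨v1, v2⟩ := hn n le_rfl
    have t1 := dist_triangle (Ψ (k i) (f (k i) (a y (k i)))) (Ψ (k i) (f (k i) (a z (k i)))) l
    have t2 := dist_triangle (Ψ (k n) (f (k n) (a y (k n)))) (Ψ (k n) (f (k n) (a z (k n)))) l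
    have t3 := dist_triangle_right (Ψ (k i) (f (k i) (a y (k i))))
      (Ψ (k n) (f (k n) (a y (k n)))) l
    linarith
  choose F hF using fun y => cauchySeq_tendsto_of_complete (hcauchy y)
  exact ⟨k, hk, F, fun y => (ha y).subseq hk, fun y =>
    ⟨(hb y).imp fun _ hR => hk.tendsto_atTop.eventually hR, hF y⟩⟩

theorem IsLimitMap.dist_map_eq (h : IsLimitMap m p Φ q Ψ f a F) (hm : IsDoublingSeq m)
    (hΦ : IsGHMap p p' Φ) (hΨ : IsGHMap q q' Ψ) {y z : X'} (hyz : dist y z < 1 / 8) :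
    dist (F y) (F z) = dist y z :=
  tendsto_nhds_unique ((h.lim y).tendsto_dist hΨ (h.lim z))
    ((h.good y).tendsto_dist_map hm hΦ (h.good z) hyz)

/-- Distances below `1/8` are preserved, and midpoints propagate the upper bound to all distances.
The reverse inequality comes from the inverse map. -/
theorem IsLimitMap.dist_map_le (h : IsLimitMap m p Φ q Ψ f a F) (hm : IsDoublingSeq m)
    (hΦ : IsGHMap p p' Φ) (hΨ : IsGHMap q q' Ψ)
    (hmid : ∀ y z : X', ∃ w, dist y w ≤ dist y z / 2 ∧ dist w z ≤ dist y z / 2) (y z : X') :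
    dist (F y) (F z) ≤ dist y z := by
  have key : ∀ (n : ℕ) (y z : X'), dist y z < 2 ^ n / 8 → dist (F y) (F z) ≤ dist y z := by
    intro n
    induction n with
    | zero =>
      intro y z hyz
      rw [pow_zero] at hyz
      exact (h.dist_map_eq hm hΦ hΨ hyz).le
    | succ n ih =>
      intro y z hyz
      obtain ⟨w, hw1, hw2⟩ := hmid y z
      rw [pow_succ] at hyz
      linarith [dist_triangle (F y) (F w) (F z), ih y w (by linarith), ih w z (by linarith)]
  obtain ⟨n, hn⟩ := pow_unbounded_of_one_lt (8 * dist y z) (one_lt_two (α := ℝ))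
  exact key n y z (by linarith)

section Measure

variable [∀ i, MeasurableSpace (Y i)] {n : ∀ i, Measure (Y i)} {U : ∀ i, Set (X i)}

theorem measure_preimage_inter_le {Z W : Type*} [MeasurableSpace Z] [MeasurableSpace W]
    {μ : Measure Z} {ν : Measure W} {g : Z → W} {V : Set Z} (hV : MeasurableSet V)
    (h : MeasurePreserving g (μ.restrict V) (ν.restrict (g '' V))) {E : Set W}
    (hE : MeasurableSet E) : μ (g ⁻¹' E ∩ V) ≤ ν E := by
  rw [← Measure.restrict_apply' hV, h.measure_preimage hE.nullMeasurableSet]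
  exact Measure.restrict_apply_le _ _

/-- The unit balls of the source have measure at most comparable to those of the target. -/
theorem exists_measure_ball_le_of_mapsTo [∀ i, BorelSpace (Y i)] (hm : IsDoublingSeq m)
    (hn : IsDoublingSeq n) (hU : ∀ i, MeasurableSet (U i)) (hUf : AsympFullMeasure m p U)
    (hpres : ∀ i, MeasurePreserving (f i) ((m i).restrict (U i)) ((n i).restrict (f i '' U i)))
    {R₀ : ℝ} {S : ∀ i, Set (X i)}
    (hS : ∀ i, S i ⊆ ball (p i) 1) (hSm : ∀ i, m i (ball (p i) 1) / 2 ≤ m i (S i))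
    (hSf : ∀ i, Set.MapsTo (f i) (S i) (ball (q i) R₀)) :
    ∃ C : ℝ≥0, ∀ᶠ i in atTop, m i (ball (p i) 1) ≤ C * n i (ball (q i) 1) := by
  obtain ⟨C, hC⟩ := hn.doubling R₀ 1 one_pos
  refine ⟨4 * C, ?_⟩
  filter_upwards [(hUf.negligible_diff hm hU 1).eventually_lt hm 4] with i hi
  set M := m i (ball (p i) 1) with hM
  have hMt : M ≠ ⊤ := (hm.lt_top i _ 1).ne
  have h1 : M ≤ 2 * m i (S i) := by
    have := hSm i
    rwa [ENNReal.div_le_iff (by simp) (by simp), mul_comm] at this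
  have h2 : m i (S i) ≤ n i (ball (q i) R₀) + m i (ball (p i) 1 \ U i) := by
    refine le_trans (measure_mono (t := (f i ⁻¹' ball (q i) R₀ ∩ U i) ∪ (ball (p i) 1 \ U i)) ?_)
      ((measure_union_le _ _).trans
        (add_le_add_left (measure_preimage_inter_le (hU i) (hpres i) measurableSet_ball) _))
    intro s hs
    by_cases hsU : s ∈ U i
    · exact Or.inl ⟨hSf i hs, hsU⟩
    · exact Or.inr ⟨hS i hs, hsU⟩
  -- The mass outside `U i` is below `M / 4`; after multiplication by 4 it is absorbed by one copy
  -- of `M`.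
  have h3 : M + M ≤ 4 * n i (ball (q i) R₀) + M := by
    calc M + M ≤ 2 * m i (S i) + 2 * m i (S i) := add_le_add h1 h1
      _ = 4 * m i (S i) := by ring
      _ ≤ 4 * (n i (ball (q i) R₀) + m i (ball (p i) 1 \ U i)) := by gcongr
      _ = 4 * n i (ball (q i) R₀) + 4 * m i (ball (p i) 1 \ U i) := by ring
      _ ≤ _ := by gcongr; exact hi.le
  have h4 := (ENNReal.add_le_add_iff_right hMt).1 h3
  calc M ≤ 4 * n i (ball (q i) R₀) := h4
    _ ≤ 4 * (C * n i (ball (q i) 1)) := by gcongr; exact hC i _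
    _ = _ := by push_cast; ring

/-- On `U i` the map preserves measure; comparability of the unit balls then adjusts the
normalization. -/
theorem Negligible.preimage {E : ∀ i, Set (Y i)} (hE : Negligible n q E)
    (hEm : ∀ i, MeasurableSet (E i)) (hU : ∀ i, MeasurableSet (U i))
    (hpres : ∀ i, MeasurePreserving (f i) ((m i).restrict (U i)) ((n i).restrict (f i '' U i)))
    {C : ℝ≥0} (hC : ∀ᶠ i in atTop, n i (ball (q i) 1) ≤ C * m i (ball (p i) 1))
    (hn : IsDoublingSeq n) (hm : IsDoublingSeq m) :
    Negligible m p fun i => f i ⁻¹' E i ∩ U i := by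
  have h1 : Tendsto (fun i => (C : ℝ≥0∞) * (n i (E i) / n i (ball (q i) 1))) atTop (𝓝 0) := by
    simpa using ENNReal.Tendsto.const_mul hE (Or.inr ENNReal.coe_ne_top)
  refine tendsto_of_tendsto_of_tendsto_of_le_of_le' tendsto_const_nhds h1
    (Eventually.of_forall fun _ => zero_le) ?_
  filter_upwards [hC] with i hi
  have h0 := (hn.pos i (q i) 1 one_pos).ne'
  have ht := (hn.lt_top i (q i) 1).ne
  rw [ENNReal.div_le_iff (hm.pos _ _ _ one_pos).ne' (hm.lt_top _ _ _).ne]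
  calc m i (f i ⁻¹' E i ∩ U i) ≤ n i (E i) := measure_preimage_inter_le (hU i) (hpres i) (hEm i)
    _ = n i (E i) / n i (ball (q i) 1) * n i (ball (q i) 1) := (ENNReal.div_mul_cancel h0 ht).symm
    _ ≤ n i (E i) / n i (ball (q i) 1) * (C * m i (ball (p i) 1)) := by gcongr
    _ = _ := by ring

/-- The limits of two sequences of maps that are inverse to each other almost everywhere are
inverse to each other. -/
theorem IsLimitMap.leftInverse [∀ i, ProperSpace (X i)] [∀ i, BorelSpace (X i)]
    [∀ i, ProperSpace (Y i)] [∀ i, BorelSpace (Y i)]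
    (h : IsLimitMap m p Φ q Ψ f a F) (hm : IsDoublingSeq m) (hn : IsDoublingSeq n)
    (hΦ : IsGHMap p p' Φ) (hΨ : IsGHMap q q' Ψ) {g : ∀ i, Y i → X i} {b : Y' → ∀ i, Y i}
    {G : Y' → X'} (h' : IsLimitMap n q Ψ p Φ g b G) (hg : ∀ i, Measurable (g i))
    (hgf : ∀ i, ∀ᵐ x ∂(m i), g i (f i x) = x)
    (hU : ∀ i, MeasurableSet (U i)) (hUf : AsympFullMeasure m p U)
    (hpres : ∀ i, MeasurePreserving (f i) ((m i).restrict (U i)) ((n i).restrict (f i '' U i)))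
    {C : ℝ≥0} (hC : ∀ᶠ i in atTop, n i (ball (q i) 1) ≤ C * m i (ball (p i) 1)) (y : X') :
    G (F y) = y := by
  have hfb := (h.lim y).tendsto_dist hΨ (h'.good (F y)).1
  have hagb := (h.good y).1.tendsto_dist hΦ (h'.lim (F y))
  rw [dist_self] at hfb
  obtain ⟨R, hR⟩ := (h.good y).1.1
  -- For generic `x` within `δ` of `a y i`, the distance from `f i x` to `b (F y) i` is below `3δ`.
  -- Applying `g i`, which returns `x`, costs another `δ`, and returning to `a y i` one more.
  have key : ∀ δ > 0, δ ≤ 1 / 16 → dist y (G (F y)) ≤ 5 * δ := by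
    intro δ hδ hδ₁
    refine le_of_tendsto hagb ?_
    have hnull : Negligible m p fun i => {x | ¬ g i (f i x) = x} := by
      have : ∀ i, m i {x | ¬ g i (f i x) = x} = 0 := fun i => ae_iff.1 (hgf i)
      simp [Negligible, this]
    have hbad := ((h'.good (F y)).2 δ hδ).preimage
      (fun i => measurableSet_badSet (hg i) δ _) hU hpres hC hn hm
    filter_upwards [hR, hfb.eventually (gt_mem_nhds hδ),
      ((((h.good y).2 δ hδ).union (hUf.negligible_diff hm hU (R + 1))).union
        (hnull.union hbad)).eventually_exists_notMem hm (R := R) hδ] with i h1 h2 h3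
    obtain ⟨x, hx, hxn⟩ := h3 _ h1
    simp only [Set.mem_union, not_or] at hxn
    obtain ⟨⟨x1, x2⟩, x3, x4⟩ := hxn
    have hxa : dist x (a y i) < δ := hx
    have h1' : dist (a y i) (p i) < R := h1
    have hxU : x ∈ U i := by
      by_contra hcon
      refine x2 ⟨?_, hcon⟩
      rw [mem_ball]
      linarith [dist_triangle x (a y i) (p i)]
    have hxg : g i (f i x) = x := not_not.1 x3
    have hxb : f i x ∉ badSet δ (g i) (b (F y) i) := fun hcon => x4 ⟨hcon, hxU⟩
    have e1 := abs_le.1 (abs_dist_sub_le_of_notMem x1 (by linarith))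
    have t1 := dist_triangle (f i x) (f i (a y i)) (b (F y) i)
    rw [dist_comm (a y i) x, dist_comm (f i (a y i)) (f i x)] at e1
    have e2 := abs_le.1 (abs_dist_sub_le_of_notMem hxb (by linarith))
    rw [hxg, dist_comm (b (F y) i)] at e2
    have t2 := dist_triangle_left (a y i) (g i (b (F y) i)) x
    rw [dist_comm x (g i _)] at t2
    linarith
  have h0 : dist y (G (F y)) ≤ 0 := by
    refine le_of_forall_pos_le_add fun ε hε => ?_
    have := key (min (ε / 5) (1 / 16)) (by positivity) (min_le_right _ _)
    linarith [min_le_left (ε / 5) (1 / 16)]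
  exact (dist_le_zero.1 h0).symm

end Measure

/-- Weak convergence to the limit map. -/
theorem IsLimitMap.convergesWeakly [∀ i, ProperSpace (X i)] [∀ i, BorelSpace (X i)]
    [∀ i, ProperSpace (Y i)] [∀ i, MeasurableSpace (Y i)] [∀ i, BorelSpace (Y i)] [ProperSpace X']
    {φ : ∀ i, X i → Option X'} {ψ : ∀ i, Y i → Option Y'}
    (h : IsLimitMap m p Φ q Ψ f a F) (hm : IsDoublingSeq m)
    (hΦ : IsGHMap p p' Φ) (hΨ : IsGHMap q q' Ψ) (hf : ∀ i, Measurable (f i))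
    (hφ : ∀ R, ∀ᶠ i in atTop, ∀ x ∈ ball (p i) R, φ i x = some (Φ i x))
    (hψ : ∀ R, ∀ᶠ i in atTop, ∀ x ∈ ball (q i) R, ψ i x = some (Ψ i x))
    (hF : ∀ y z, dist (F y) (F z) ≤ dist y z) :
    ConvergesWeakly m p φ ψ f F := by
  classical
  have key : ∀ k : ℕ, ∀ᶠ i in atTop, ∃ V : Set (X i), MeasurableSet V ∧
      m i (ball (p i) k \ V) ≤ ENNReal.ofReal (1 / ((k : ℝ) + 1)) * m i (ball (p i) 1) ∧
      ∀ x ∈ V, extDist (ψ i (f i x)) ((φ i x).map F) ≤ ENNReal.ofReal (1 / ((k : ℝ) + 1)) := by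
    intro k
    set ε : ℝ := 1 / ((k : ℝ) + 1) with hε
    have hε0 : 0 < ε := by positivity
    -- The final estimate accumulates five errors of size `δ`; `δ ≤ 1/8` keeps the net points within
    -- the `1/4` range of the bad sets.
    obtain ⟨δ, hδ, hδ₁, hδ₂⟩ : ∃ δ > 0, δ ≤ ε / 8 ∧ δ ≤ 1 / 8 :=
      ⟨min (ε / 8) (1 / 8), by positivity, min_le_left _ _, min_le_right _ _⟩
    obtain ⟨t, ht⟩ := hΦ.exists_finite_net k hδ
    have hneg := Negligible.biUnion t (F := fun y i => badSet δ (f i) (a y i))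
      fun y _ => (h.good y).2 δ hδ
    choose B hB using fun y => (h.lim y).1
    obtain ⟨D, hD⟩ : ∃ D, ∀ y ∈ t, B y ≤ D := by
      obtain ⟨D, hD⟩ := (t.image B).bddAbove
      exact ⟨D, fun y hy => hD (by simpa using ⟨y, hy, rfl⟩)⟩
    have hnear : ∀ y ∈ t, ∀ᶠ i in atTop, f i (a y i) ∈ ball (q i) (B y) ∧
        dist (Ψ i (f i (a y i))) (F y) < δ := fun y _ => (hB y).and
      ((tendsto_iff_dist_tendsto_zero.1 (h.lim y).2).eventually (gt_mem_nhds hδ))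
    filter_upwards [ht a fun y _ => (h.good y).1, (Finset.eventually_all t).2 hnear,
      hφ k, hψ (D + 1), hΨ.dist_le (D + 1) δ hδ,
      Tendsto.eventually hneg (gt_mem_nhds (ENNReal.ofReal_pos.2 hε0))] with i h1 h2 h3 h4 h5 h6
    refine ⟨ball (p i) k \ ⋃ y ∈ t, badSet δ (f i) (a y i), ?_, ?_, ?_⟩
    · exact measurableSet_ball.diff
        (Finset.measurableSet_biUnion t fun y _ => measurableSet_badSet (hf i) δ _)
    · rw [ENNReal.div_lt_iff (Or.inl (hm.pos _ _ _ one_pos).ne')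
        (Or.inl (hm.lt_top _ _ _).ne)] at h6
      refine (measure_mono ?_).trans h6.le
      intro x hx
      by_contra hcon
      exact hx.2 ⟨hx.1, hcon⟩
    · rintro x ⟨hx, hxn⟩
      obtain ⟨y, hy, hy1, hy2⟩ := h1 x hx
      obtain ⟨h7, h8⟩ := h2 y hy
      have h7' : dist (f i (a y i)) (q i) < B y := h7
      have hxb : x ∉ badSet δ (f i) (a y i) := fun hcon => hxn (Set.mem_biUnion hy hcon)
      have e1 := abs_le.1 (abs_dist_sub_le_of_notMem hxb (by linarith))
      rw [dist_comm (a y i) x, dist_comm (f i (a y i))] at e1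
      have hB' := hD y hy
      have m1 : f i (a y i) ∈ ball (q i) (D + 1) := by
        rw [mem_ball]; linarith
      have m2 : f i x ∈ ball (q i) (D + 1) := by
        rw [mem_ball]; linarith [dist_triangle (f i x) (f i (a y i)) (q i)]
      have e2 := abs_le.1 (h5 _ m2 _ m1)
      rw [h3 x hx, h4 _ m2]
      change edist (Ψ i (f i x)) (F (Φ i x)) ≤ _
      rw [edist_dist]
      apply ENNReal.ofReal_le_ofReal
      have e3 := hF y (Φ i x)
      rw [dist_comm y] at e3
      linarith [dist_triangle4 (Ψ i (f i x)) (Ψ i (f i (a y i))) (F y) (F (Φ i x))]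
  obtain ⟨κ, hκ, hP⟩ := exists_tendsto_eventually key
  have hε : Tendsto (fun i => ENNReal.ofReal (1 / ((κ i : ℝ) + 1))) atTop (𝓝 0) := by
    simpa using ENNReal.tendsto_ofReal (tendsto_one_div_add_atTop_nhds_zero_nat.comp hκ)
  -- A measurable set is needed for every index; the empty set fills the initial indices where the
  -- estimate is not available.
  have hchoice : ∀ i, ∃ V : Set (X i), MeasurableSet V ∧ ((∃ V : Set (X i), MeasurableSet V ∧
      m i (ball (p i) (κ i) \ V) ≤ ENNReal.ofReal (1 / ((κ i : ℝ) + 1)) * m i (ball (p i) 1) ∧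
      ∀ x ∈ V, extDist (ψ i (f i x)) ((φ i x).map F) ≤ ENNReal.ofReal (1 / ((κ i : ℝ) + 1))) →
      m i (ball (p i) (κ i) \ V) ≤ ENNReal.ofReal (1 / ((κ i : ℝ) + 1)) * m i (ball (p i) 1) ∧
      ∀ x ∈ V, extDist (ψ i (f i x)) ((φ i x).map F) ≤
        ENNReal.ofReal (1 / ((κ i : ℝ) + 1))) := by
    intro i
    by_cases hex : ∃ V : Set (X i), MeasurableSet V ∧
      m i (ball (p i) (κ i) \ V) ≤ ENNReal.ofReal (1 / ((κ i : ℝ) + 1)) * m i (ball (p i) 1) ∧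
      ∀ x ∈ V, extDist (ψ i (f i x)) ((φ i x).map F) ≤ ENNReal.ofReal (1 / ((κ i : ℝ) + 1))
    · obtain ⟨V, hV, hV'⟩ := hex
      exact ⟨V, hV, fun _ => hV'⟩
    · exact ⟨∅, MeasurableSet.empty, fun hex' => absurd hex' hex⟩
  choose V hV hV' using hchoice
  refine ⟨V, hV, asympFullMeasure_of_negligible_diff hm hV fun R => ?_, ?_⟩
  · refine tendsto_of_tendsto_of_tendsto_of_le_of_le' tendsto_const_nhds hε
      (Eventually.of_forall fun _ => zero_le) ?_
    obtain ⟨N, hN⟩ := exists_nat_ge R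
    filter_upwards [hP, hκ.eventually_ge_atTop N] with i hi hiN
    refine ENNReal.div_le_of_le_mul (le_trans (measure_mono ?_) (hV' i hi).1)
    exact Set.sdiff_subset_sdiff_left (ball_subset_ball (hN.trans (by exact_mod_cast hiN)))
  · refine tendsto_of_tendsto_of_tendsto_of_le_of_le' tendsto_const_nhds hε
      (Eventually.of_forall fun _ => zero_le) ?_
    filter_upwards [hP] with i hi
    exact iSup₂_le (hV' i hi).2

end LimitMap


/-! ### Conclusion for RCD* spaces -/

theorem isDoublingSeq_of_isRCDStar {K N : ℝ} {X : ℕ → Type u} [∀ i, MetricSpace (X i)]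
    [∀ i, ProperSpace (X i)] [∀ i, MeasurableSpace (X i)] [∀ i, BorelSpace (X i)]
    {m : ∀ i, Measure (X i)} (h : ∀ i, IsRCDStar K N (m i)) : IsDoublingSeq m where
  lt_top i := (h i).ball_lt_top
  pos i := (h i).fullSupport
  doubling R r hr := by
    obtain ⟨C, hC⟩ := IsRCDStar.exists_measure_ball_le_measure_ball.{u} K N (R := R) hr
    exact ⟨C, fun i => hC (h i)⟩

end RCD

theorem mainTheorem7 (K N : ℝ)
    {X Y : ℕ → Type*}
    [∀ i, MetricSpace (X i)] [∀ i, ProperSpace (X i)]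
    [∀ i, MeasurableSpace (X i)] [∀ i, BorelSpace (X i)]
    [∀ i, MetricSpace (Y i)] [∀ i, ProperSpace (Y i)]
    [∀ i, MeasurableSpace (Y i)] [∀ i, BorelSpace (Y i)]
    (m : ∀ i, Measure (X i)) (n : ∀ i, Measure (Y i))
    (p : ∀ i, X i) (q : ∀ i, Y i)
    (hX : ∀ i, RCD.IsRCDStar K N (m i)) (hY : ∀ i, RCD.IsRCDStar K N (n i))
    {X' Y' : Type*} [MetricSpace X'] [ProperSpace X'] [MetricSpace Y'] [ProperSpace Y']
    (p' : X') (q' : Y')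
    (φ : ∀ i, X i → Option X') (ψ : ∀ i, Y i → Option Y')
    (hφ : RCD.IsGHApprox p p' φ) (hψ : RCD.IsGHApprox q q' ψ)
    (f : ∀ i, X i → Y i) (hf : RCD.IsGoodAtAllScales m p n q f) :
    ∃ k : ℕ → ℕ, StrictMono k ∧ ∃ F : X' ≃ᵢ Y',
      RCD.ConvergesWeakly (fun i => m (k i)) (fun i => p (k i)) (fun i => φ (k i))
        (fun i => ψ (k i)) (fun i => f (k i)) F := by
  obtain ⟨hfm, g, hgm, hgf, hfg, -, -, ⟨R₀, -, S, T, hST⟩, ε, hε, U, V, hUm, hVm, hU, hV,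
    hfU, hgV⟩ := hf
  have hm := RCD.isDoublingSeq_of_isRCDStar hX
  have hn := RCD.isDoublingSeq_of_isRCDStar hY
  have := fun i => (hX i).sigmaFinite
  have := fun i => (hY i).sigmaFinite
  have hΦ := hφ.isGHMap
  have hΨ := hψ.isGHMap
  have hmidX := hΦ.exists_midpoint fun i x y δ hδ => (hX i).exists_approx_midpoint x y hδ
  have hmidY := hΨ.exists_midpoint fun i x y δ hδ => (hY i).exists_approx_midpoint x y hδ
  have hgoodf := RCD.exists_goodLift hm hΦ hfm hUm hU hε
    fun i x hx => by simpa using (hfU i).meanDistortion x hx 1 one_pos le_rfl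
  have hgoodg := RCD.exists_goodLift hn hΨ hgm hVm hV hε
    fun i x hx => by simpa using (hgV i).meanDistortion x hx 1 one_pos le_rfl
  have hbf := fun y a (ha : RCD.GoodLift m p _ f a y) => ha.exists_map_mem_ball hm hΦ hmidX hgoodf
    (fun i => (hST i).1.1) (fun i => (hST i).1.2.2.1) (fun i => (hST i).1.2.2.2)
  have hbg := fun y b (hb : RCD.GoodLift n q _ g b y) => hb.exists_map_mem_ball hn hΨ hmidY hgoodg
    (fun i => (hST i).2.1) (fun i => (hST i).2.2.2.1) (fun i => (hST i).2.2.2.2)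
  -- Both comparisons of unit masses are needed: the one derived from `g` serves to pull negligible
  -- sets back by `f`, and conversely.
  obtain ⟨C, hC⟩ := RCD.exists_measure_ball_le_of_mapsTo hm hn hUm hU
    (fun i => (hfU i).measurePreserving)
    (fun i => (hST i).1.1) (fun i => (hST i).1.2.2.1) (fun i => (hST i).1.2.2.2)
  obtain ⟨D, hD⟩ := RCD.exists_measure_ball_le_of_mapsTo hn hm hVm hV
    (fun i => (hgV i).measurePreserving)
    (fun i => (hST i).2.1) (fun i => (hST i).2.2.2.1) (fun i => (hST i).2.2.2.2)
  choose a ha using hgoodf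
  choose b hb using hgoodg
  obtain ⟨k₁, hk₁, F, hF₁⟩ := RCD.exists_isLimitMap hm hΦ hΨ ha fun y => hbf y _ (ha y)
  obtain ⟨k₂, hk₂, G, hG⟩ := RCD.exists_isLimitMap (hn.subseq k₁) (hΨ.subseq hk₁) (hΦ.subseq hk₁)
    (fun y => (hb y).subseq hk₁)
    fun y => (hbg y _ (hb y)).imp fun R hR => hk₁.tendsto_atTop.eventually hR
  have hF := hF₁.subseq hk₂
  have hk := hk₁.comp hk₂
  have hm' := hm.subseq (k₁ ∘ k₂)
  have hn' := hn.subseq (k₁ ∘ k₂)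
  have hΦ' := hΦ.subseq hk
  have hΨ' := hΨ.subseq hk
  have hGF := hF.leftInverse hm' hn' hΦ' hΨ' hG (fun i => hgm _) (fun i => hgf _) (fun i => hUm _)
    (fun R hR => (hU R hR).comp hk.tendsto_atTop) (fun i => (hfU _).measurePreserving)
    (hk.tendsto_atTop.eventually hD)
  have hFG := hG.leftInverse hn' hm' hΨ' hΦ' hF (fun i => hfm _) (fun i => hfg _) (fun i => hVm _)
    (fun R hR => (hV R hR).comp hk.tendsto_atTop) (fun i => (hgV _).measurePreserving)
    (hk.tendsto_atTop.eventually hC)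
  have hFl := hF.dist_map_le hm' hΦ' hΨ' hmidX
  have hGl := hG.dist_map_le hn' hΨ' hΦ' hmidY
  refine ⟨k₁ ∘ k₂, hk, ⟨⟨F, G, hGF, hFG⟩, Isometry.of_dist_eq fun y z => ?_⟩, ?_⟩
  -- Since `G` is 1-Lipschitz and `G ∘ F = id`, the map `F` cannot shrink distances.
  · refine le_antisymm (hFl y z) ?_
    have := hGl (F y) (F z)
    rwa [hGF, hGF] at this
  · exact hF.convergesWeakly hm' hΦ' hΨ' (fun i => hfm _)
      (fun R => hk.tendsto_atTop.eventually (hφ.eventually_eq_some R))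
      (fun R => hk.tendsto_atTop.eventually (hψ.eventually_eq_some R)) hFl
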